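/- **Theorem (Regret bound for OPD-Min-ESTR).** *Setting.* Let $V$ be a finite set and $\mathbf s\in[-1,1]^V$ with $\sum_i s_i=0$, $\mathbf s\neq 0$; put $\Theta^*=\mathbf s\mathbf s^\top$. Let $L_1,\dots,L_K$ ($K\ge 1$) be Laplacians of undirected graphs on $V$ with nonnegative edge weights, and let $\mathcal X=\{X_i\}$ with $X_i=(I+L_i)^{-1}$. The loss of $X$ is $f(X)=\langle\Theta^*,X\rangle=\mathbf s^\top X\mathbf s$; let $X^*$ minimize $f$ over $\mathcal X$. In round $t$ the learner plays $X_t\in\mathcal X$ and observes $Y_t=f(X_t)+\eta_t$, with $\eta_t$ i.i.d. $N(0,\sigma^2)$ and $\sigma\le\sigma_0$ for a known $\sigma_0>0$. The regret is $R_T=\sum_{t=1}^T(f(X_t)-f(X^*))$. Call a matrix *balanced* if it is symmetric and the all-ones vector is an eigenvector of it (forest matrices and $\Theta^*$ are balanced). *Algorithm.* Fix $\delta\in(0,1)$. Stage 1: play $X_1,\dots,X_{T_1}$, chosen (possibly at random) independently of the noise; let $\widehat\Theta$ be a balanced minimizer over all $\Theta\in\mathbb R^{V\times V}$ of $$\frac1{2T_1}\sum_{t\le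 T_1}(Y_t-\langle X_t,\Theta\rangle)^2+\lambda\|\Theta\|_{\rm nuc},\qquad \lambda=2\sigma_0\sqrt{\frac{2\log(2|V|/\delta)}{T_1}}.$$ Let $\hat{\mathbf s}$ be a unit eigenvector of $\widehat\Theta$ for its largest eigenvalue and $[\hat{\mathbf s},\widehat S_\perp]$ an orthogonal matrix. For a matrix $A$ let $x_{\rm sub}(A)\in\mathbb R^{k}$, $k=2|V|-1$, collect $\hat{\mathbf s}^\top A\hat{\mathbf s}$, $\widehat S_\perp^\top A\hat{\mathbf s}$ and $\hat{\mathbf s}^\top A\widehat S_\perp$. Stage 2: in rounds $T_1<t\le T$ a linear bandit algorithm (an arbitrary, possibly randomized rule whose random seed, jointly with the Stage-1 arms, is independent of the noise) chooses $X_t$ from the reduced arms $x_{\rm sub}(X_i)$ and the arms and losses seen so far in Stage 2. Its in-subspace regret is $$R^{\rm sub}_T=\sum_{t=T_1+1}^T\langle x_{\rm sub}(X_t)-x_{\rm sub}(X^*),\,x_{\rm sub}(\Theta^*)\rangle .$$ (If $T_1\ge T$, only Stage 1 is played in the $T$ rounds.) *RSC.* Let $P=I-\mathbf s\mathbf s^\top/\|\mathbf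 s\|^2$ and $\mathcal C=\{\Delta:\|P\Delta P\|_{\rm nuc}\le 3\|\Delta-P\Delta P\|_{\rm nuc}\}$. The exploration design satisfies RSC with parameters $\kappa>0$, $\tau^2\ge0$ if for all balanced $\Delta\in\mathcal C$ $$\frac1{2T_1}\sum_{t\le T_1}\langle X_t,\Delta\rangle^2\ \ge\ \frac\kappa2\|\Delta\|_F^2-\tau^2\|\Delta\|_{\rm nuc}^2 .$$ *Claim.* For all constants $\sigma_0>0$, $0<c_1\le c_2$, $c_\tau,C_0\ge0$, $p\in\mathbb N$ there are $B,C>0$ and $q\in\mathbb N$, depending on these constants only, such that the following holds for all instances as above, all $T\ge1$, and all $\delta_1,\delta_2\ge0$. Suppose that 1. $c_1A\le T_1\le c_2A$, where $A=\frac{1}{\|\mathbf s\|^2\kappa}\sqrt{T\log(2|V|/\delta)}$; 2. either $128\,\tau^2\le\kappa$; or $\kappa\le1$, $\tau^2\le c_\tau\Big(\sqrt{\tfrac{\log(2|V|/\delta)}{T_1}}+\tfrac{\log(2|V|/\delta)}{T_1}\Big)$ and $T\ge B\,\frac{\|\mathbf s\|^4}{\kappa^2}\log(2|V|/\delta)$;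 3. RSC with parameters $\kappa,\tau^2$ holds with probability at least $1-\delta_1$; 4. $R^{\rm sub}_T\le C_0\,\log^p(2|V|T/\delta)\;k\sqrt T$ with probability at least $1-\delta_2$. Then with probability at least $1-\delta-\delta_1-\delta_2$ (that is, $1-\delta$ when 3 and 4 hold almost surely) $$R_T\ \le\ C\,\log^q\!\Big(\frac{2|V|T}{\delta}\Big)\,\max\Big\{\frac1\kappa,\sqrt{|V|}\Big\}\sqrt{|V|\,T}.$$ -/

import Mathlib

open MeasureTheory ProbabilityTheory Matrix
open scoped NNReal

noncomputable section

namespace OPDMin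

/-- An undirected edge-weighted graph on `V`; weight `0` means that the edge is absent. -/
structure WeightedGraph (V : Type*) where
  weight : V → V → ℝ
  symm : ∀ i j, weight i j = weight j i
  loopless : ∀ i, weight i i = 0
  nonneg : ∀ i j, 0 ≤ weight i j

section Matrices

variable {V : Type*} [Fintype V] [DecidableEq V]

/-- The Laplacian `L = D - A`. -/
def WeightedGraph.laplacian (G : WeightedGraph V) : Matrix V V ℝ :=
  Matrix.diagonal (fun i => ∑ j, G.weight i j) - Matrix.of G.weight

/-- The forest matrix `(I + L)⁻¹`, the action that belongs to the intervention `L`. -/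
def WeightedGraph.forest (G : WeightedGraph V) : Matrix V V ℝ :=
  (1 + G.laplacian)⁻¹

/-- The trace inner product `⟨A, B⟩ = tr (Aᵀ B)`. -/
def traceInner {m n : Type*} [Fintype m] [Fintype n] (A B : Matrix m n ℝ) : ℝ :=
  (Aᵀ * B).trace

/-- The squared Frobenius norm. -/
def frobSq (A : Matrix V V ℝ) : ℝ := traceInner A A

/-- The nuclear norm, the sum of the singular values. -/
def nuclearNorm (A : Matrix V V ℝ) : ℝ :=
  ∑ i ∈ Finset.range (Fintype.card V), (Matrix.toEuclideanLin A).singularValues i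

/-- The unknown parameter `Θ* = s sᵀ`. -/
def theta (s : V → ℝ) : Matrix V V ℝ := Matrix.vecMulVec s s

/-- The loss `f(X) = ⟨Θ*, X⟩`. -/
def loss (s : V → ℝ) (X : Matrix V V ℝ) : ℝ := traceInner (theta s) X

/-- Symmetric matrices that have the all-ones vector as an eigenvector. All forest matrices
are of this kind, and so is `s sᵀ` for a mean-centered `s`. -/
def IsBalanced (A : Matrix V V ℝ) : Prop :=
  Aᵀ = A ∧ ∃ c : ℝ, A *ᵥ (fun _ => 1) = fun _ => c

/-- The orthogonal projection of `Δ` onto `{Δ | Δ s = 0 and sᵀ Δ = 0}`, namely `P Δ P` with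
`P = I - s sᵀ / ‖s‖²`. -/
def perpPart (s : V → ℝ) (Δ : Matrix V V ℝ) : Matrix V V ℝ :=
  (1 - (s ⬝ᵥ s)⁻¹ • theta s) * Δ * (1 - (s ⬝ᵥ s)⁻¹ • theta s)

/-- The cone of error matrices: with `M̄ = {s aᵀ + b sᵀ}`, the nuclear norm of the component
orthogonal to `M̄` is at most three times that of the component in `M̄`. -/
def errorCone (s : V → ℝ) : Set (Matrix V V ℝ) :=
  {Δ | nuclearNorm (perpPart s Δ) ≤ 3 * nuclearNorm (Δ - perpPart s Δ)}

/-- Restricted strong convexity of the design `X₁, …, X_{T₁}` with curvature `κ` and tolerance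
`τ2` (which stands for `τ²`), over the balanced matrices in the error cone. -/
def RSC {T₁ : ℕ} (X : Fin T₁ → Matrix V V ℝ) (s : V → ℝ) (κ τ2 : ℝ) : Prop :=
  ∀ Δ : Matrix V V ℝ, IsBalanced Δ → Δ ∈ errorCone s →
    κ / 2 * frobSq Δ - τ2 * nuclearNorm Δ ^ 2
      ≤ 1 / (2 * (T₁ : ℝ)) * ∑ t, traceInner (X t) Δ ^ 2

/-- The nuclear-norm penalized least-squares objective for the arms `X` and the data
`(i₁, Y₁), …, (i_{T₁}, Y_{T₁})`. -/
def objective {ι : Type*} {T₁ : ℕ} (X : ι → Matrix V V ℝ) (lam : ℝ) (h : Fin T₁ → ι × ℝ)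
    (Θ : Matrix V V ℝ) : ℝ :=
  1 / (2 * (T₁ : ℝ)) * ∑ t, ((h t).2 - traceInner (X (h t).1) Θ) ^ 2 + lam * nuclearNorm Θ

/-- `v` is a unit eigenvector of `A` for the largest eigenvalue. -/
def IsTopEigenvector (A : Matrix V V ℝ) (v : V → ℝ) : Prop :=
  v ⬝ᵥ v = 1 ∧ ∃ μ : ℝ, A *ᵥ v = μ • v ∧ ∀ u : V → ℝ, u ⬝ᵥ (A *ᵥ u) ≤ μ * (u ⬝ᵥ u)

/-- Index type of the reduced vectors, of size `1 + (|V| - 1) + (|V| - 1)`. -/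
abbrev SubIdx (V : Type*) [Fintype V] : Type :=
  Unit ⊕ (Fin (Fintype.card V - 1) ⊕ Fin (Fintype.card V - 1))

/-- The reduced vector of a matrix: the entry `ŝᵀ A ŝ`, the column `Ŝ⊥ᵀ A ŝ` and the row
`ŝᵀ A Ŝ⊥` of the rotated matrix `[ŝ Ŝ⊥]ᵀ A [ŝ Ŝ⊥]`. -/
def reduce (v : V → ℝ) (S : Matrix V (Fin (Fintype.card V - 1)) ℝ) (A : Matrix V V ℝ) :
    SubIdx V → ℝ :=
  Sum.elim (fun _ => v ⬝ᵥ (A *ᵥ v)) (Sum.elim (Sᵀ *ᵥ (A *ᵥ v)) ((v ᵥ* A) ᵥ* S))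

/-- The two-stage algorithm for the arms `X`, exploration length `T₁` and regularization
parameter `lam`. Everything it computes is a function of the data seen so far. -/
structure ESTR {ι : Type*} (X : ι → Matrix V V ℝ) (T₁ : ℕ) (lam : ℝ) (Seed : Type*) where
  /-- The estimator: a minimizer of the objective over all `|V| × |V|` matrices, where ties are
  broken in favour of balanced minimizers. -/
  thetaHat : (Fin T₁ → ι × ℝ) → Matrix V V ℝ
  thetaHat_min : ∀ h Θ, objective X lam h (thetaHat h) ≤ objective X lam h Θ
  thetaHat_balanced : ∀ h, IsBalanced (thetaHat h)
  /-- The top eigenvector `ŝ` of the estimator. -/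
  sHat : (Fin T₁ → ι × ℝ) → V → ℝ
  sHat_top : ∀ h, IsTopEigenvector (thetaHat h) (sHat h)
  /-- The completion `Ŝ⊥` of `ŝ` to an orthonormal basis. -/
  sPerp : (Fin T₁ → ι × ℝ) → Matrix V (Fin (Fintype.card V - 1)) ℝ
  sPerp_orthonormal : ∀ h, (sPerp h)ᵀ * sPerp h = 1
  sPerp_orthogonal : ∀ h, (sPerp h)ᵀ *ᵥ sHat h = 0
  /-- The linear bandit algorithm of Stage 2: from the reduced arm set, the arms played and the
  losses observed so far in Stage 2, and a random seed, it selects the next arm. -/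
  select : (j : ℕ) → (ι → SubIdx V → ℝ) → (Fin j → ι × ℝ) → Seed → ι

/-- The arms and losses of rounds `a, …, a + j - 1` (rounds are counted from `0`), when the arm
`arm t` and the noise `η t` occur in round `t`. -/
def history {ι : Type*} (X : ι → Matrix V V ℝ) (s : V → ℝ) (arm : ℕ → ι) (η : ℕ → ℝ) (a j : ℕ) :
    Fin j → ι × ℝ :=
  fun t => (arm (a + t), loss s (X (arm (a + t))) + η (a + t))

/-- The reduction map `A ↦ x_sub(A)` that the algorithm has computed after Stage 1. -/
def ESTR.sub {ι : Type*} {X : ι → Matrix V V ℝ} {T₁ : ℕ} {lam : ℝ} {Seed : Type*}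
    (alg : ESTR X T₁ lam Seed) (s : V → ℝ) (arm : ℕ → ι) (η : ℕ → ℝ) :
    Matrix V V ℝ → SubIdx V → ℝ :=
  reduce (alg.sHat (history X s arm η 0 T₁)) (alg.sPerp (history X s arm η 0 T₁))

/-- From round `T₁` on, the arms are the ones that the Stage 2 bandit selects. -/
def ESTR.Follows {ι : Type*} {X : ι → Matrix V V ℝ} {T₁ : ℕ} {lam : ℝ} {Seed : Type*}
    (alg : ESTR X T₁ lam Seed) (s : V → ℝ) (arm : ℕ → ι) (η : ℕ → ℝ) (u : Seed) : Prop :=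
  ∀ j : ℕ, arm (T₁ + j) =
    alg.select j (fun i => alg.sub s arm η (X i)) (history X s arm η T₁ j) u

/-- The cumulative regret `R_T` relative to the arm `best`. -/
def regret {ι : Type*} (X : ι → Matrix V V ℝ) (s : V → ℝ) (best : ι) (arm : ℕ → ι) (T : ℕ) : ℝ :=
  ∑ t ∈ Finset.range T, (loss s (X (arm t)) - loss s (X best))

/-- The regret of Stage 2 within the estimated subspace,
`∑_{T₁ < t ≤ T} ⟨x_sub(X_t) - x_sub(X*), θ*_sub⟩`. -/
def ESTR.subRegret {ι : Type*} {X : ι → Matrix V V ℝ} {T₁ : ℕ} {lam : ℝ} {Seed : Type*}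
    (alg : ESTR X T₁ lam Seed) (s : V → ℝ) (best : ι) (arm : ℕ → ι) (η : ℕ → ℝ) (T : ℕ) : ℝ :=
  ∑ t ∈ Finset.Ico T₁ T,
    (alg.sub s arm η (X (arm t)) - alg.sub s arm η (X best)) ⬝ᵥ alg.sub s arm η (theta s)

end Matrices

end OPDMin

end

/-!
The regret splits into three parts. Stage 1 costs at most `‖s‖²` per round, because every forest
matrix `X` satisfies `0 ≤ X ≤ I`. In Stage 2 the reduced inner product misses, for each arm, only
the quadratic form `wᵀ X w` at the component `w` of `s` orthogonal to `ŝ`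
(`dotProduct_mulVec_eq_reduce_add`), so that beyond the in-subspace regret a round costs at most
`‖w‖²` (`regret_le`). With the prescribed exploration length all parts are of the claimed order
once `‖w‖² = O(λ² / (κ² ‖s‖²))` is known (`regret_bound_arith`).

The bound on `w` is deterministic, given restricted strong convexity and the event that the noise
matrix `∑ ηₜ Xₜ` has operator norm at most `T₁ λ / 2`. Optimality of the estimator, the duality of
operator and nuclear norms and the decomposability of the nuclear norm place the error
`Δ = Θ̂ - Θ*` in the cone and bound `κ ‖Δ‖_F` by a multiple of `λ` (`frobSq_sub_theta_le`).
Comparing Rayleigh quotients at `ŝ` and at `s` then gives `‖s‖² ‖w‖² ≤ 2 ‖Δ‖_F²`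
(`dotProduct_self_mul_le_of_isTopEigenvector`). If the tolerance is not assumed to be at most
`κ / 128`, the length of the horizon makes it so (`tolerance_le_of_horizon`).

The noise event fails with probability at most `δ` (`measure_not_noise_bound_le`). Conditionally on
the design this is the tail bound for a Gaussian matrix series with contractions as coefficients.
It is obtained from the Laplace transform `𝔼 tr cosh (θ ∑ ηₜ Xₜ)` by adding one summand at a time.
Neither matrix exponentials nor the Golden–Thompson inequality are needed: for symmetric `H` and a
symmetric contraction `X`,
`tr cosh (H + t X) + tr cosh (H - t X) ≤ 2 cosh t · tr cosh H`
(`coshTrace_add_coshTrace_le`). In the power series this holds term by term, by induction on the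
order and a comparison of second derivatives in `t` (`evenMoment_add_evenMoment_le`), because
`tr (X Y^q X Y^r) ≤ tr Y^(q + r)` for symmetric `Y` and even `q + r`
(`trace_mul_pow_mul_mul_pow_le`).
-/

open scoped ENNReal InnerProductSpace

namespace OPDMin

variable {V : Type*} [Fintype V] [DecidableEq V]

/-! ### Duality between the operator norm and the nuclear norm -/

/-- `W` has operator norm at most one for the Euclidean norm. -/
def IsContraction (W : Matrix V V ℝ) : Prop := ∀ x : V → ℝ, (W *ᵥ x) ⬝ᵥ (W *ᵥ x) ≤ x ⬝ᵥ x

lemma inner_toEuclideanLin (A B : Matrix V V ℝ) (x y : EuclideanSpace ℝ V) :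
    ⟪Matrix.toEuclideanLin A x, Matrix.toEuclideanLin B y⟫_ℝ = (A *ᵥ x.ofLp) ⬝ᵥ (B *ᵥ y.ofLp) := by
  simp [EuclideanSpace.inner_eq_star_dotProduct, dotProduct_comm]

lemma isContraction_iff_norm_le (W : Matrix V V ℝ) :
    IsContraction W ↔ ∀ x, ‖Matrix.toEuclideanLin W x‖ ≤ ‖x‖ := by
  have key : ∀ x : EuclideanSpace ℝ V, ‖Matrix.toEuclideanLin W x‖ ≤ ‖x‖ ↔
      (W *ᵥ x.ofLp) ⬝ᵥ (W *ᵥ x.ofLp) ≤ x.ofLp ⬝ᵥ x.ofLp := by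
    intro x
    have h2 := inner_toEuclideanLin 1 1 x x
    simp only [one_mulVec, Matrix.toLpLin_one, LinearMap.id_apply] at h2
    rw [← inner_toEuclideanLin, ← h2, real_inner_self_eq_norm_sq, real_inner_self_eq_norm_sq,
      sq_le_sq₀ (norm_nonneg _) (norm_nonneg _)]
  exact ⟨fun h x => (key x).2 (h _), fun h x => (key (WithLp.toLp 2 x)).1 (h _)⟩

/-- The trace inner product may be computed in any orthonormal basis. -/
lemma traceInner_eq_sum_inner {ι : Type*} [Fintype ι]
    (b : OrthonormalBasis ι ℝ (EuclideanSpace ℝ V)) (W A : Matrix V V ℝ) :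
    traceInner W A = ∑ i, ⟪Matrix.toEuclideanLin W (b i), Matrix.toEuclideanLin A (b i)⟫_ℝ := by
  have h := LinearMap.trace_eq_sum_inner (Matrix.toEuclideanLin (Wᵀ * A)) b
  have h2 : LinearMap.trace ℝ _ (Matrix.toEuclideanLin (Wᵀ * A)) = (Wᵀ * A).trace := by
    rw [Matrix.toEuclideanLin_eq_toLin_orthonormal]
    exact Matrix.trace_toLin_eq _ _
  rw [traceInner, ← h2, h]
  refine Finset.sum_congr rfl fun i _ => ?_
  rw [inner_toEuclideanLin]
  have := inner_toEuclideanLin 1 (Wᵀ * A) (b i) (b i)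
  simp only [one_mulVec, Matrix.toLpLin_one, LinearMap.id_apply] at this
  rw [this, ← Matrix.mulVec_mulVec, Matrix.dotProduct_mulVec, Matrix.vecMul_transpose]

/-- In an eigenbasis of `Aᵀ A` the images of the basis vectors are orthogonal, and their lengths are
the singular values. -/
lemma nuclearNorm_eq_sum_norm (A : Matrix V V ℝ) :
    ∃ b : OrthonormalBasis (Fin (Fintype.card V)) ℝ (EuclideanSpace ℝ V),
      nuclearNorm A = ∑ i, ‖Matrix.toEuclideanLin A (b i)‖ ∧
      Pairwise fun i j => ⟪Matrix.toEuclideanLin A (b i), Matrix.toEuclideanLin A (b j)⟫_ℝ = 0 := by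
  have hn : Module.finrank ℝ (EuclideanSpace ℝ V) = Fintype.card V := finrank_euclideanSpace
  set T := Matrix.toEuclideanLin A
  let hT := T.isSymmetric_adjoint_comp_self
  let b := hT.eigenvectorBasis hn
  have key : ∀ i j, ⟪T (b i), T (b j)⟫_ℝ = if i = j then hT.eigenvalues hn j else 0 := by
    intro i j
    have h1 := hT.apply_eigenvectorBasis hn j
    rw [← LinearMap.adjoint_inner_right, ← LinearMap.comp_apply, h1, inner_smul_right]
    have := b.orthonormal
    rw [orthonormal_iff_ite] at this
    simp only [b] at this ⊢
    rw [this]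
    simp
  refine ⟨b, ?_, fun i j hij => (key i j).trans (if_neg hij)⟩
  rw [nuclearNorm, Finset.sum_range]
  refine Finset.sum_congr rfl fun i _ => ?_
  rw [LinearMap.singularValues_fin T hn i, norm_eq_sqrt_real_inner, key, if_pos rfl]

lemma traceInner_le_nuclearNorm {W : Matrix V V ℝ} (hW : IsContraction W) (A : Matrix V V ℝ) :
    traceInner W A ≤ nuclearNorm A := by
  obtain ⟨b, hb, -⟩ := nuclearNorm_eq_sum_norm A
  rw [hb, traceInner_eq_sum_inner b]
  refine Finset.sum_le_sum fun i _ => (real_inner_le_norm _ _).trans ?_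
  have := (isContraction_iff_norm_le W).1 hW (b i)
  rw [b.norm_eq_one] at this
  exact mul_le_of_le_one_left (norm_nonneg _) this

/-- The nuclear norm is attained in trace duality: the partial isometry of the polar decomposition
of `A` is a contraction pairing with `A` to its nuclear norm. -/
lemma exists_isContraction_traceInner_eq (A : Matrix V V ℝ) :
    ∃ W : Matrix V V ℝ, IsContraction W ∧ traceInner W A = nuclearNorm A := by
  obtain ⟨b, hb, ho⟩ := nuclearNorm_eq_sum_norm A
  set T := Matrix.toEuclideanLin A
  let w : EuclideanSpace ℝ V →ₗ[ℝ] EuclideanSpace ℝ V :=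
    b.toBasis.constr ℝ fun i => ‖T (b i)‖⁻¹ • T (b i)
  have hw : ∀ i, w (b i) = ‖T (b i)‖⁻¹ • T (b i) := by
    intro i
    simpa only [OrthonormalBasis.coe_toBasis] using
      b.toBasis.constr_basis ℝ (fun i => ‖T (b i)‖⁻¹ • T (b i)) i
  have hW : Matrix.toEuclideanLin (Matrix.toEuclideanLin.symm w) = w := by simp
  refine ⟨Matrix.toEuclideanLin.symm w, ?_, ?_⟩
  · rw [isContraction_iff_norm_le, hW]
    intro x
    rw [← sq_le_sq₀ (norm_nonneg _) (norm_nonneg _)]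
    have hx := b.sum_repr' x
    have h1 : w x = ∑ i, (⟪b i, x⟫_ℝ * ‖T (b i)‖⁻¹) • T (b i) := by
      conv_lhs => rw [← hx]
      simp [map_sum, hw, mul_smul]
    have h2 : ‖w x‖ ^ 2 = ∑ i, ⟪b i, x⟫_ℝ ^ 2 * (‖T (b i)‖⁻¹ * ‖T (b i)‖) ^ 2 := by
      rw [← real_inner_self_eq_norm_sq, h1, sum_inner]
      refine Finset.sum_congr rfl fun i _ => ?_
      rw [inner_sum, Finset.sum_eq_single i]
      · rw [inner_smul_left, inner_smul_right, real_inner_self_eq_norm_sq]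
        simp only [conj_trivial]
        ring
      · intro j _ hj
        rw [inner_smul_left, inner_smul_right, ho hj.symm]; simp
      · simp
    rw [h2, ← b.sum_sq_inner_right x]
    refine Finset.sum_le_sum fun i _ => ?_
    by_cases h0 : ‖T (b i)‖ = 0
    · rw [h0]; simp; positivity
    · rw [inv_mul_cancel₀ h0]; simp
  · rw [hb, traceInner_eq_sum_inner b, hW]
    refine Finset.sum_congr rfl fun i _ => ?_
    rw [hw, inner_smul_left, real_inner_self_eq_norm_sq]
    by_cases h0 : ‖T (b i)‖ = 0
    · rw [h0]; simp
    · simp only [conj_trivial]; field_simp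

/-! ### Trace inner product, nuclear norm and its decomposability -/

section TraceInner
variable {m n : Type*} [Fintype m] [Fintype n]

lemma traceInner_eq_sum (A B : Matrix m n ℝ) : traceInner A B = ∑ i, ∑ j, A i j * B i j := by
  rw [traceInner, Matrix.trace, Finset.sum_comm]
  simp [Matrix.mul_apply]

lemma traceInner_comm (A B : Matrix m n ℝ) : traceInner A B = traceInner B A := by
  simp only [traceInner_eq_sum, mul_comm]

lemma traceInner_add_right (A B C : Matrix m n ℝ) :
    traceInner A (B + C) = traceInner A B + traceInner A C := by
  simp [traceInner, Matrix.mul_add]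

lemma traceInner_sub_right (A B C : Matrix m n ℝ) :
    traceInner A (B - C) = traceInner A B - traceInner A C := by
  simp [traceInner, Matrix.mul_sub]

lemma traceInner_smul_left (c : ℝ) (A B : Matrix m n ℝ) :
    traceInner (c • A) B = c * traceInner A B := by
  simp [traceInner]

lemma traceInner_sum_left {ι : Type*} (t : Finset ι) (A : ι → Matrix m n ℝ) (B : Matrix m n ℝ) :
    traceInner (∑ i ∈ t, A i) B = ∑ i ∈ t, traceInner (A i) B := by
  simp [traceInner, Matrix.transpose_sum, Matrix.sum_mul, Matrix.trace_sum]

lemma traceInner_vecMulVec (A : Matrix m n ℝ) (a : m → ℝ) (b : n → ℝ) :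
    traceInner A (vecMulVec a b) = a ⬝ᵥ (A *ᵥ b) := by
  simp only [traceInner_eq_sum, dotProduct, mulVec, vecMulVec_apply, Finset.mul_sum]
  exact Finset.sum_congr rfl fun i _ => Finset.sum_congr rfl fun j _ => by ring

/-- Cauchy–Schwarz for the trace inner product. -/
lemma traceInner_sq_le (A B : Matrix m n ℝ) :
    traceInner A B ^ 2 ≤ traceInner A A * traceInner B B := by
  simp only [traceInner_eq_sum, ← Finset.sum_product']
  have := Finset.sum_mul_sq_le_sq_mul_sq (Finset.univ ×ˢ Finset.univ)
    (fun p : m × n => A p.1 p.2) (fun p => B p.1 p.2)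
  simpa only [sq] using this

lemma traceInner_self_nonneg (A : Matrix m n ℝ) : 0 ≤ traceInner A A := by
  rw [traceInner_eq_sum]
  exact Finset.sum_nonneg fun i _ => Finset.sum_nonneg fun j _ => mul_self_nonneg _

end TraceInner

lemma dotProduct_sq_le {n : Type*} [Fintype n] (a b : n → ℝ) :
    (a ⬝ᵥ b) ^ 2 ≤ (a ⬝ᵥ a) * (b ⬝ᵥ b) := by
  have := Finset.sum_mul_sq_le_sq_mul_sq Finset.univ a b
  simpa only [sq, dotProduct] using this

lemma dotProduct_self_nonneg {n : Type*} [Fintype n] (a : n → ℝ) : 0 ≤ a ⬝ᵥ a :=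
  Finset.sum_nonneg fun _ _ => mul_self_nonneg _

omit [DecidableEq V] in
lemma mulVec_dotProduct_self_le (A : Matrix V V ℝ) (x : V → ℝ) :
    (A *ᵥ x) ⬝ᵥ (A *ᵥ x) ≤ frobSq A * (x ⬝ᵥ x) := by
  rw [frobSq, traceInner_eq_sum, Finset.sum_mul, dotProduct]
  refine Finset.sum_le_sum fun i _ => ?_
  have := dotProduct_sq_le (fun j => A i j) x
  rwa [sq] at this

omit [DecidableEq V] in
lemma frobSq_nonneg (A : Matrix V V ℝ) : 0 ≤ frobSq A := traceInner_self_nonneg A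

omit [DecidableEq V] in
lemma frobSq_vecMulVec (a b : V → ℝ) : frobSq (vecMulVec a b) = (a ⬝ᵥ a) * (b ⬝ᵥ b) := by
  rw [frobSq, traceInner_vecMulVec, vecMulVec_mulVec]
  simp [dotProduct_smul, mul_comm]

lemma nuclearNorm_nonneg (A : Matrix V V ℝ) : 0 ≤ nuclearNorm A :=
  Finset.sum_nonneg fun _ _ => LinearMap.singularValues_nonneg _ _

lemma nuclearNorm_add_le (A B : Matrix V V ℝ) :
    nuclearNorm (A + B) ≤ nuclearNorm A + nuclearNorm B := by
  obtain ⟨W, hW, h⟩ := exists_isContraction_traceInner_eq (A + B)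
  rw [← h, traceInner_add_right]
  exact add_le_add (traceInner_le_nuclearNorm hW A) (traceInner_le_nuclearNorm hW B)

omit [DecidableEq V] in
lemma IsContraction.neg {W : Matrix V V ℝ} (hW : IsContraction W) : IsContraction (-W) := by
  intro x; simpa [neg_mulVec] using hW x

lemma nuclearNorm_neg (A : Matrix V V ℝ) : nuclearNorm (-A) = nuclearNorm A := by
  have key : ∀ B : Matrix V V ℝ, nuclearNorm (-B) ≤ nuclearNorm B := by
    intro B
    obtain ⟨W, hW, h⟩ := exists_isContraction_traceInner_eq (-B)
    have := traceInner_le_nuclearNorm hW.neg B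
    rw [← h]
    simpa [traceInner] using this
  exact le_antisymm (key A) (by simpa using key (-A))

/-- The trace dual of the operator norm: a multiple `a • W` of a contraction pairs with `A` to at
most `a ‖A‖_nuc`. -/
lemma traceInner_le_mul_nuclearNorm {W : Matrix V V ℝ} {a : ℝ} (ha : 0 < a)
    (hW : ∀ x, (W *ᵥ x) ⬝ᵥ (W *ᵥ x) ≤ a ^ 2 * (x ⬝ᵥ x)) (A : Matrix V V ℝ) :
    traceInner W A ≤ a * nuclearNorm A := by
  have h : IsContraction (a⁻¹ • W) := by
    intro x
    rw [smul_mulVec, smul_dotProduct, dotProduct_smul, smul_eq_mul, smul_eq_mul]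
    calc a⁻¹ * (a⁻¹ * ((W *ᵥ x) ⬝ᵥ (W *ᵥ x))) ≤ a⁻¹ * (a⁻¹ * (a ^ 2 * (x ⬝ᵥ x))) := by
          gcongr; exact hW x
      _ = x ⬝ᵥ x := by field_simp
  have := traceInner_le_nuclearNorm h A
  rw [traceInner_smul_left, inv_mul_le_iff₀ ha] at this
  exact this

lemma nuclearNorm_vecMulVec_sq_le (a b : V → ℝ) :
    nuclearNorm (vecMulVec a b) ^ 2 ≤ (a ⬝ᵥ a) * (b ⬝ᵥ b) := by
  obtain ⟨W, hW, h⟩ := exists_isContraction_traceInner_eq (vecMulVec a b)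
  rw [← h, traceInner_vecMulVec]
  exact (dotProduct_sq_le _ _).trans
    (mul_le_mul_of_nonneg_left (hW b) (dotProduct_self_nonneg a))

section Cone
variable {s : V → ℝ}

omit [DecidableEq V] in
lemma dotProduct_self_pos (hs : s ≠ 0) : 0 < s ⬝ᵥ s :=
  lt_of_le_of_ne (dotProduct_self_nonneg s) fun h => hs (dotProduct_self_eq_zero.1 h.symm)

/-- The projection `s sᵀ / ‖s‖²` onto the line of `s`. -/
noncomputable def lineProj (s : V → ℝ) : Matrix V V ℝ := (s ⬝ᵥ s)⁻¹ • theta s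

omit [DecidableEq V] in
lemma lineProj_mulVec (s x : V → ℝ) : lineProj s *ᵥ x = ((s ⬝ᵥ s)⁻¹ * (s ⬝ᵥ x)) • s := by
  rw [lineProj, theta, smul_mulVec, vecMulVec_mulVec]
  simp [mul_smul]

omit [DecidableEq V] in
lemma lineProj_transpose (s : V → ℝ) : (lineProj s)ᵀ = lineProj s := by
  simp [lineProj, theta, transpose_vecMulVec]

lemma lineProj_mul_self (hs : s ≠ 0) : lineProj s * lineProj s = lineProj s := by
  have := (dotProduct_self_pos hs).ne'
  rw [lineProj, theta, smul_mul_smul_comm, vecMulVec_mul_vecMulVec, vecMulVec_smul, smul_smul]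
  congr 1
  field_simp

lemma perpPart_eq (s : V → ℝ) (Δ : Matrix V V ℝ) :
    perpPart s Δ = (1 - lineProj s) * Δ * (1 - lineProj s) := rfl

lemma sub_perpPart (s : V → ℝ) (Δ : Matrix V V ℝ) :
    Δ - perpPart s Δ = lineProj s * Δ + (1 - lineProj s) * Δ * lineProj s := by
  rw [perpPart_eq]; noncomm_ring

/-- Splitting the squared Frobenius norm along an orthogonal projection. -/
lemma frobSq_lineProj_add (hs : s ≠ 0) (Δ : Matrix V V ℝ) :
    frobSq (lineProj s * Δ) + frobSq ((1 - lineProj s) * Δ) = frobSq Δ := by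
  have h := lineProj_mul_self hs
  have h3 : ((lineProj s * Δ)ᵀ * (lineProj s * Δ))
      + (((1 - lineProj s) * Δ)ᵀ * ((1 - lineProj s) * Δ))
      = Δᵀ * Δ + 2 • (Δᵀ * (lineProj s * lineProj s - lineProj s) * Δ) := by
    simp only [transpose_mul, transpose_sub, transpose_one, lineProj_transpose]
    noncomm_ring
  simp only [frobSq, traceInner]
  rw [← trace_add, h3, h]
  simp

/-- The part of a matrix in `M̄ = {s aᵀ + b sᵀ}` has rank at most two, so its nuclear norm is at
most `√2` times its Frobenius norm. -/
lemma nuclearNorm_sub_perpPart_sq_le (hs : s ≠ 0) (Δ : Matrix V V ℝ) :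
    nuclearNorm (Δ - perpPart s Δ) ^ 2 ≤ 2 * frobSq Δ := by
  have hS := dotProduct_self_pos hs
  set S := s ⬝ᵥ s with hSdef
  have e1 : lineProj s * Δ = vecMulVec s (S⁻¹ • (s ᵥ* Δ)) := by
    rw [lineProj, theta, smul_mul, vecMulVec_mul, vecMulVec_smul]
  have e2 : (1 - lineProj s) * Δ * lineProj s
      = vecMulVec (((1 - lineProj s) * Δ) *ᵥ s) (S⁻¹ • s) := by
    conv_lhs => rw [lineProj, theta, mul_smul_comm, mul_vecMulVec, ← vecMulVec_smul]
    rfl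
  have h1 : nuclearNorm (lineProj s * Δ) ^ 2 ≤ frobSq (lineProj s * Δ) := by
    rw [e1, frobSq_vecMulVec]; exact nuclearNorm_vecMulVec_sq_le _ _
  have h2 : nuclearNorm ((1 - lineProj s) * Δ * lineProj s) ^ 2
      ≤ frobSq ((1 - lineProj s) * Δ) := by
    rw [e2]
    refine (nuclearNorm_vecMulVec_sq_le _ _).trans ?_
    have h3 : (S⁻¹ • s) ⬝ᵥ (S⁻¹ • s) = S⁻¹ := by
      rw [smul_dotProduct, dotProduct_smul, ← hSdef, smul_eq_mul, smul_eq_mul]; field_simp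
    rw [h3]
    calc _ ≤ frobSq ((1 - lineProj s) * Δ) * S * S⁻¹ := by
          gcongr; exact mulVec_dotProduct_self_le _ _
      _ = _ := by field_simp
  have h4 := nuclearNorm_add_le (lineProj s * Δ) ((1 - lineProj s) * Δ * lineProj s)
  rw [sub_perpPart]
  rw [← frobSq_lineProj_add hs Δ]
  have h0 := nuclearNorm_nonneg (lineProj s * Δ + (1 - lineProj s) * Δ * lineProj s)
  nlinarith [sq_nonneg (nuclearNorm (lineProj s * Δ)
    - nuclearNorm ((1 - lineProj s) * Δ * lineProj s))]

lemma nuclearNorm_theta_le (s : V → ℝ) : nuclearNorm (theta s) ≤ s ⬝ᵥ s :=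
  (sq_le_sq₀ (nuclearNorm_nonneg _) (dotProduct_self_nonneg s)).1
    ((nuclearNorm_vecMulVec_sq_le s s).trans_eq (sq _).symm)

/-- Decomposability of the nuclear norm: `s sᵀ` and `P Δ P` have orthogonal row and column spaces,
and if `W` attains the norm of `P Δ P`, then `s sᵀ / ‖s‖² + P W P` attains that of the sum. -/
lemma add_nuclearNorm_perpPart_le (hs : s ≠ 0) (Δ : Matrix V V ℝ) :
    s ⬝ᵥ s + nuclearNorm (perpPart s Δ) ≤ nuclearNorm (theta s + perpPart s Δ) := by
  have hS := dotProduct_self_pos hs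
  obtain ⟨W, hW, hWA⟩ := exists_isContraction_traceInner_eq (perpPart s Δ)
  set Q := lineProj s with hQ
  have hQt : Qᵀ = Q := lineProj_transpose s
  have hQQ : Q * Q = Q := lineProj_mul_self hs
  have hPt : (1 - Q)ᵀ = 1 - Q := by rw [transpose_sub, transpose_one, hQt]
  have hPP : (1 - Q) * (1 - Q) = 1 - Q := by
    rw [sub_mul, one_mul, mul_sub, mul_one, hQQ, sub_self, sub_zero]
  have hQP : Q * (1 - Q) = 0 := by rw [mul_sub, mul_one, hQQ, sub_self]
  have hPQ : (1 - Q) * Q = 0 := by rw [sub_mul, one_mul, hQQ, sub_self]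
  have hth : theta s = (s ⬝ᵥ s) • Q := by
    rw [hQ, lineProj, smul_smul, mul_inv_cancel₀ hS.ne', one_smul]
  have hproj : ∀ (R : Matrix V V ℝ) (x : V → ℝ), Rᵀ = R → R * R = R →
      (R *ᵥ x) ⬝ᵥ (R *ᵥ x) = x ⬝ᵥ (R *ᵥ x) := by
    intro R x h1 h2
    rw [dotProduct_mulVec, vecMul_mulVec, ← dotProduct_mulVec, h1, h2]
  have hcontr : IsContraction (Q + (1 - Q) * W * (1 - Q)) := by
    intro x
    rw [add_mulVec]
    set a := Q *ᵥ x
    set b := (1 - Q) *ᵥ x with hb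
    have e1 : ((1 - Q) * W * (1 - Q)) *ᵥ x = (1 - Q) *ᵥ (W *ᵥ b) := by
      rw [hb]; simp only [mulVec_mulVec, Matrix.mul_assoc]
    rw [e1]
    have e2 : a ⬝ᵥ ((1 - Q) *ᵥ (W *ᵥ b)) = 0 := by
      rw [dotProduct_mulVec, vecMul_mulVec, ← mulVec_transpose, transpose_mul]
      simp [hQt, hPQ]
    have e3 : ((1 - Q) *ᵥ (W *ᵥ b)) ⬝ᵥ ((1 - Q) *ᵥ (W *ᵥ b)) ≤ b ⬝ᵥ b := by
      refine le_trans ?_ (hW b)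
      set y := W *ᵥ b
      have h1 := hproj (1 - Q) y hPt hPP
      have h2 := hproj Q y hQt hQQ
      have h3 := dotProduct_self_nonneg (Q *ᵥ y)
      rw [h1, sub_mulVec, one_mulVec, dotProduct_sub, ← h2]
      linarith
    have e4 : a ⬝ᵥ a + b ⬝ᵥ b = x ⬝ᵥ x := by
      rw [hproj Q x hQt hQQ, hproj (1 - Q) x hPt hPP, sub_mulVec, one_mulVec, dotProduct_sub]
      ring
    rw [add_dotProduct, dotProduct_add, dotProduct_add, e2,
      dotProduct_comm ((1 - Q) *ᵥ (W *ᵥ b)) a, e2]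
    linarith
  have hval : traceInner (Q + (1 - Q) * W * (1 - Q)) (theta s + perpPart s Δ)
      = s ⬝ᵥ s + nuclearNorm (perpPart s Δ) := by
    have hQs : Q *ᵥ s = s := by
      rw [hQ, lineProj_mulVec, inv_mul_cancel₀ hS.ne', one_smul]
    have t1 : traceInner Q (theta s) = s ⬝ᵥ s := by
      rw [theta, traceInner_vecMulVec, hQs]
    have t2 : traceInner ((1 - Q) * W * (1 - Q)) (theta s) = 0 := by
      rw [theta, traceInner_vecMulVec, ← mulVec_mulVec, sub_mulVec, one_mulVec, hQs]
      simp
    have t3 : traceInner Q (perpPart s Δ) = 0 := by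
      rw [perpPart_eq, ← hQ, traceInner, hQt, ← Matrix.mul_assoc, ← Matrix.mul_assoc, hQP]
      simp
    have t4 : traceInner ((1 - Q) * W * (1 - Q)) (perpPart s Δ) = traceInner W (perpPart s Δ) := by
      rw [perpPart_eq, ← hQ, traceInner, traceInner]
      simp only [transpose_mul, hPt]
      calc ((1 - Q) * (Wᵀ * (1 - Q)) * ((1 - Q) * Δ * (1 - Q))).trace
          = ((Wᵀ * ((1 - Q) * (1 - Q))) * (Δ * ((1 - Q) * (1 - Q)))).trace := by
            rw [Matrix.mul_assoc (1 - Q), trace_mul_comm (1 - Q)]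
            simp only [Matrix.mul_assoc]
        _ = _ := by
            rw [hPP]
            simp only [Matrix.mul_assoc]
    have add_left : ∀ A B C : Matrix V V ℝ,
        traceInner (A + B) C = traceInner A C + traceInner B C := by
      intro A B C
      rw [traceInner_comm, traceInner_add_right, traceInner_comm C, traceInner_comm C]
    rw [add_left, traceInner_add_right, traceInner_add_right, t1, t2, t3, t4, hWA]
    ring
  rw [← hval]
  exact traceInner_le_nuclearNorm hcontr _

end Cone

/-! ### Forest matrices -/

section Forest
variable (G : WeightedGraph V)

lemma WeightedGraph.laplacian_transpose : G.laplacianᵀ = G.laplacian := by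
  ext i j
  simp only [WeightedGraph.laplacian, transpose_apply, Matrix.sub_apply, of_apply, G.symm j i]
  by_cases h : i = j
  · subst h; rfl
  · rw [diagonal_apply_ne _ h, diagonal_apply_ne _ (Ne.symm h)]

lemma WeightedGraph.dotProduct_laplacian_nonneg (x : V → ℝ) : 0 ≤ x ⬝ᵥ (G.laplacian *ᵥ x) := by
  have e : x ⬝ᵥ (G.laplacian *ᵥ x) = ∑ i, ∑ j, G.weight i j * (x i * (x i - x j)) := by
    have hd : ∀ d : V → ℝ, diagonal d *ᵥ x = fun i => d i * x i := fun d =>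
      funext fun i => mulVec_diagonal d x i
    rw [WeightedGraph.laplacian, sub_mulVec, dotProduct_sub, hd]
    simp only [dotProduct, mulVec, of_apply, Finset.mul_sum, Finset.sum_mul,
      ← Finset.sum_sub_distrib]
    exact Finset.sum_congr rfl fun i _ => Finset.sum_congr rfl fun j _ => by ring
  have e' : x ⬝ᵥ (G.laplacian *ᵥ x) = ∑ i, ∑ j, G.weight i j * (x j * (x j - x i)) := by
    rw [e, Finset.sum_comm]
    exact Finset.sum_congr rfl fun i _ => Finset.sum_congr rfl fun j _ => by rw [G.symm]
  have h : 0 ≤ ∑ i, ∑ j, G.weight i j * (x i - x j) ^ 2 :=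
    Finset.sum_nonneg fun i _ => Finset.sum_nonneg fun j _ =>
      mul_nonneg (G.nonneg i j) (sq_nonneg _)
  have h2 : ∑ i, ∑ j, G.weight i j * (x i - x j) ^ 2
      = x ⬝ᵥ (G.laplacian *ᵥ x) + x ⬝ᵥ (G.laplacian *ᵥ x) := by
    nth_rw 1 [e]
    rw [e']
    simp only [← Finset.sum_add_distrib]
    exact Finset.sum_congr rfl fun i _ => Finset.sum_congr rfl fun j _ => by ring
  linarith

lemma WeightedGraph.isUnit_det_one_add_laplacian : IsUnit (1 + G.laplacian).det := by
  rw [isUnit_iff_ne_zero]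
  intro h
  obtain ⟨x, hx, h0⟩ := exists_mulVec_eq_zero_iff.2 h
  have h1 : x ⬝ᵥ ((1 + G.laplacian) *ᵥ x) = x ⬝ᵥ x + x ⬝ᵥ (G.laplacian *ᵥ x) := by
    rw [add_mulVec, one_mulVec, dotProduct_add]
  rw [h0, dotProduct_zero] at h1
  have := G.dotProduct_laplacian_nonneg x
  have := dotProduct_self_pos hx
  linarith

lemma WeightedGraph.forest_transpose : G.forestᵀ = G.forest := by
  rw [WeightedGraph.forest, transpose_nonsing_inv, transpose_add, transpose_one,
    G.laplacian_transpose]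

lemma WeightedGraph.forest_mulVec_add (x : V → ℝ) :
    G.forest *ᵥ x + G.laplacian *ᵥ (G.forest *ᵥ x) = x := by
  have := mul_nonsing_inv _ G.isUnit_det_one_add_laplacian
  calc _ = (1 + G.laplacian) *ᵥ (G.forest *ᵥ x) := by rw [add_mulVec, one_mulVec]
    _ = x := by rw [mulVec_mulVec, WeightedGraph.forest, this, one_mulVec]

lemma WeightedGraph.forest_isContraction : IsContraction G.forest := by
  intro x
  have h := G.forest_mulVec_add x
  set y := G.forest *ᵥ x
  have h1 := G.dotProduct_laplacian_nonneg y
  have h2 := dotProduct_self_nonneg (G.laplacian *ᵥ y)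
  rw [← h, add_dotProduct, dotProduct_add, dotProduct_add, dotProduct_comm (G.laplacian *ᵥ y) y]
  linarith

lemma WeightedGraph.dotProduct_forest_nonneg (x : V → ℝ) : 0 ≤ x ⬝ᵥ (G.forest *ᵥ x) := by
  have h := G.forest_mulVec_add x
  set y := G.forest *ᵥ x
  have h1 := G.dotProduct_laplacian_nonneg y
  have h2 := dotProduct_self_nonneg y
  rw [← h, add_dotProduct, dotProduct_comm (G.laplacian *ᵥ y) y]
  linarith

lemma WeightedGraph.dotProduct_forest_le (x : V → ℝ) : x ⬝ᵥ (G.forest *ᵥ x) ≤ x ⬝ᵥ x := by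
  have h := G.forest_mulVec_add x
  set y := G.forest *ᵥ x
  have h1 := G.dotProduct_laplacian_nonneg y
  have h2 := dotProduct_self_nonneg (G.laplacian *ᵥ y)
  rw [← h, add_dotProduct, add_dotProduct, dotProduct_add, dotProduct_add,
    dotProduct_comm (G.laplacian *ᵥ y) y]
  linarith

end Forest

/-! ### The subspace of a perturbed eigenvector -/

section Subspace
variable {s v : V → ℝ}

omit [DecidableEq V] in
lemma loss_eq (s : V → ℝ) (X : Matrix V V ℝ) : loss s X = s ⬝ᵥ (X *ᵥ s) := by
  rw [loss, traceInner_comm, theta, traceInner_vecMulVec]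

/-- A unit vector and an orthonormal basis of its complement resolve the identity. -/
lemma vecMulVec_add_mul_transpose_eq_one {S : Matrix V (Fin (Fintype.card V - 1)) ℝ}
    (hv : v ⬝ᵥ v = 1) (hS : Sᵀ * S = 1) (hSv : Sᵀ *ᵥ v = 0) :
    vecMulVec v v + S * Sᵀ = 1 := by
  have hcard : 0 < Fintype.card V := by
    rw [Fintype.card_pos_iff]
    by_contra h
    rw [not_nonempty_iff] at h
    simp [dotProduct] at hv
  let M : Matrix V (Unit ⊕ Fin (Fintype.card V - 1)) ℝ := fromCols (replicateCol Unit v) S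
  have h1 : Mᵀ * M = 1 := by
    have hvS : v ᵥ* S = 0 := by rw [← mulVec_transpose, hSv]
    rw [transpose_fromCols, fromRows_mul_fromCols, ← fromBlocks_one]
    congr 1
    · ext i j; simpa [replicateCol, mul_apply, dotProduct] using hv
    · ext i j; simpa [replicateCol, mul_apply, vecMul, dotProduct] using congrFun hvS j
    · ext i j; simpa [replicateCol, mul_apply, mulVec, dotProduct] using congrFun hSv i
  have h2 : M * Mᵀ = 1 :=
    (Matrix.mul_eq_one_comm_of_card_eq _ _ _
      (by simp only [Fintype.card_sum, Fintype.card_unit, Fintype.card_fin]; omega)).1 h1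
  rw [← h2, transpose_fromCols, fromCols_mul_fromRows]
  congr 1
  ext i j
  simp [vecMulVec_apply, replicateCol, mul_apply]

/-- The reduced inner product misses only the quadratic form of `A` at the component of `s`
orthogonal to `v`. -/
lemma dotProduct_mulVec_eq_reduce_add {S : Matrix V (Fin (Fintype.card V - 1)) ℝ}
    (hv : v ⬝ᵥ v = 1) (hS : Sᵀ * S = 1) (hSv : Sᵀ *ᵥ v = 0) (A : Matrix V V ℝ) :
    s ⬝ᵥ (A *ᵥ s) = reduce v S A ⬝ᵥ reduce v S (theta s)
      + (s - (v ⬝ᵥ s) • v) ⬝ᵥ (A *ᵥ (s - (v ⬝ᵥ s) • v)) := by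
  have hw : S *ᵥ (Sᵀ *ᵥ s) = s - (v ⬝ᵥ s) • v := by
    have := congrArg (· *ᵥ s) (vecMulVec_add_mul_transpose_eq_one hv hS hSv)
    simp only [add_mulVec, one_mulVec, vecMulVec_mulVec, ← mulVec_mulVec] at this
    rw [op_smul_eq_smul] at this
    exact eq_sub_of_add_eq' this
  set c := v ⬝ᵥ s with hc
  set w := s - c • v with hwdef
  have hs : s = c • v + w := by rw [hwdef]; abel
  have hred : reduce v S A ⬝ᵥ reduce v S (theta s)
      = (v ⬝ᵥ (A *ᵥ v)) * (c * c) + (A *ᵥ v) ⬝ᵥ (S *ᵥ (Sᵀ *ᵥ s)) * c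
        + (v ᵥ* A) ⬝ᵥ (S *ᵥ (Sᵀ *ᵥ s)) * c := by
    simp only [reduce, theta, vecMulVec_mulVec, vecMul_vecMulVec, sumElim_dotProduct_sumElim]
    rw [dotProduct_comm s v, ← hc]
    have e1 : (Sᵀ *ᵥ (A *ᵥ v)) ⬝ᵥ (Sᵀ *ᵥ (MulOpposite.op c • s))
        = (A *ᵥ v) ⬝ᵥ (S *ᵥ (Sᵀ *ᵥ s)) * c := by
      rw [op_smul_eq_smul, mulVec_smul, dotProduct_smul, mulVec_transpose,
        ← dotProduct_mulVec, smul_eq_mul, mul_comm]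
    have e2 : (v ᵥ* A ᵥ* S) ⬝ᵥ ((c • s) ᵥ* S) = (v ᵥ* A) ⬝ᵥ (S *ᵥ (Sᵀ *ᵥ s)) * c := by
      rw [smul_vecMul, dotProduct_smul, ← mulVec_transpose S s, ← dotProduct_mulVec, smul_eq_mul,
        mul_comm]
    rw [e1, e2]
    simp [dotProduct_smul, ← hc, add_assoc]
  rw [hred, hw, ← dotProduct_mulVec]
  conv_lhs => rw [hs]
  simp only [mulVec_add, mulVec_smul, dotProduct_add, add_dotProduct, smul_dotProduct,
    dotProduct_smul, smul_eq_mul]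
  rw [dotProduct_comm w (A *ᵥ v)]
  ring

omit [DecidableEq V] in
lemma dotProduct_self_sub_smul (hv : v ⬝ᵥ v = 1) :
    (s - (v ⬝ᵥ s) • v) ⬝ᵥ (s - (v ⬝ᵥ s) • v) = s ⬝ᵥ s - (v ⬝ᵥ s) ^ 2 := by
  simp only [sub_dotProduct, dotProduct_sub, smul_dotProduct, dotProduct_smul, smul_eq_mul, hv,
    dotProduct_comm s v]
  ring

omit [DecidableEq V] in
/-- A `sin Θ` theorem for the rank-one matrix `s sᵀ`: comparing the Rayleigh quotients of the
perturbed matrix at its top eigenvector `v` and at `s` bounds the distance of `s` from the line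
of `v`. -/
lemma dotProduct_self_mul_le_of_isTopEigenvector (hs : s ≠ 0) {Θ : Matrix V V ℝ}
    (hv : IsTopEigenvector Θ v) :
    (s ⬝ᵥ s) * ((s - (v ⬝ᵥ s) • v) ⬝ᵥ (s - (v ⬝ᵥ s) • v)) ≤ 2 * frobSq (Θ - theta s) := by
  obtain ⟨hv1, μ, hμ, hmax⟩ := hv
  have hS := dotProduct_self_pos hs
  rw [dotProduct_self_sub_smul hv1]
  set c := v ⬝ᵥ s with hc
  set S := s ⬝ᵥ s with hSdef
  have hSc : 0 ≤ S - c ^ 2 := by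
    rw [hc, hSdef, ← dotProduct_self_sub_smul hv1]; exact dotProduct_self_nonneg _
  set Δ := Θ - theta s with hΔ
  have hq : ∀ x : V → ℝ, x ⬝ᵥ (Θ *ᵥ x) = x ⬝ᵥ (Δ *ᵥ x) + (s ⬝ᵥ x) ^ 2 := by
    intro x
    have : Θ = Δ + theta s := by rw [hΔ]; abel
    rw [this, add_mulVec, dotProduct_add, theta, vecMulVec_mulVec, op_smul_eq_smul,
      dotProduct_smul, smul_eq_mul, dotProduct_comm x s, sq]
  have h1 := hmax s
  have h2 : μ = v ⬝ᵥ (Θ *ᵥ v) := by rw [hμ, dotProduct_smul, hv1]; simp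
  rw [h2, hq, hq, dotProduct_comm s v, ← hc, ← hSdef] at h1
  -- The difference of the two Rayleigh quotients of `Δ`, scaled by `S`, is a pairing with `D`.
  set D := S • vecMulVec v v - vecMulVec s s with hD
  have h3 : traceInner Δ D = S * (v ⬝ᵥ (Δ *ᵥ v)) - s ⬝ᵥ (Δ *ᵥ s) := by
    rw [hD, traceInner_sub_right, traceInner_vecMulVec, traceInner_comm, traceInner_smul_left,
      traceInner_comm, traceInner_vecMulVec]
  have h4 : traceInner D D = 2 * S * (S - c ^ 2) := by
    have e1 : D *ᵥ v = S • v - c • s := by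
      rw [hD, sub_mulVec, smul_mulVec, vecMulVec_mulVec, vecMulVec_mulVec, hv1,
        dotProduct_comm s v, ← hc]
      simp
    have e2 : D *ᵥ s = (S * c) • v - S • s := by
      rw [hD, sub_mulVec, smul_mulVec, vecMulVec_mulVec, vecMulVec_mulVec, ← hc, ← hSdef]
      simp [mul_smul]
    have e3 : traceInner D D = S * (v ⬝ᵥ (D *ᵥ v)) - s ⬝ᵥ (D *ᵥ s) := by
      nth_rw 2 [hD]
      rw [traceInner_sub_right, traceInner_vecMulVec, traceInner_comm, traceInner_smul_left,
        traceInner_comm, traceInner_vecMulVec]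
    rw [e3, e1, e2]
    simp only [dotProduct_sub, dotProduct_smul, smul_eq_mul, hv1, dotProduct_comm s v, ← hc,
      ← hSdef]
    ring
  have h5 : S * (S - c ^ 2) ≤ traceInner Δ D := by rw [h3]; nlinarith
  have h6 := traceInner_sq_le Δ D
  rw [h4] at h6
  have h7 : 0 ≤ S * (S - c ^ 2) := mul_nonneg hS.le hSc
  rcases h7.eq_or_lt with h0 | h0
  · rw [← h0]; exact mul_nonneg zero_le_two (frobSq_nonneg _)
  · refine le_of_mul_le_mul_right ?_ h0
    calc _ ≤ traceInner Δ D ^ 2 := (mul_self_le_mul_self h7 h5).trans_eq (sq _).symm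
      _ ≤ _ := by rw [frobSq]; linarith

end Subspace

/-! ### Even trace moments of a matrix pencil -/

section TraceMoments

/-- The spectral theorem for a real symmetric matrix, in a form that gives all powers at once. -/
lemma exists_orthogonal_diagonalization {Y : Matrix V V ℝ} (hY : Yᵀ = Y) :
    ∃ (U : Matrix V V ℝ) (d : V → ℝ), Uᵀ * U = 1 ∧ U * Uᵀ = 1 ∧
      ∀ q : ℕ, Y ^ q = U * diagonal (fun i => d i ^ q) * Uᵀ := by
  have hH : Y.IsHermitian := by rw [IsHermitian, conjTranspose_eq_transpose_of_trivial, hY]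
  have hs := hH.spectral_theorem
  have hU := hH.eigenvectorUnitary.2
  set U : Matrix V V ℝ := (hH.eigenvectorUnitary : Matrix V V ℝ) with hUdef
  have h1 : Uᵀ * U = 1 := by
    simpa [star_eq_conjTranspose] using (Unitary.mem_iff.1 hU).1
  have h2 : U * Uᵀ = 1 := by
    simpa [star_eq_conjTranspose] using (Unitary.mem_iff.1 hU).2
  have h3 : Y = U * diagonal hH.eigenvalues * Uᵀ := by
    conv_lhs => rw [hs]
    simp [Unitary.conjStarAlgAut_apply, star_eq_conjTranspose, hUdef]
  refine ⟨U, hH.eigenvalues, h1, h2, fun q => ?_⟩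
  induction q with
  | zero => simp [h2]
  | succ q ih =>
    rw [pow_succ, ih]
    nth_rw 2 [h3]
    calc _ = U * diagonal (fun i => hH.eigenvalues i ^ q) * (Uᵀ * U)
          * diagonal hH.eigenvalues * Uᵀ := by simp only [Matrix.mul_assoc]
      _ = _ := by rw [h1, Matrix.mul_one, Matrix.mul_assoc U, diagonal_mul_diagonal]; rfl

lemma pow_mul_pow_add_le {a b : ℝ} (q r : ℕ) (h : Even (q + r)) :
    a ^ q * b ^ r + b ^ q * a ^ r ≤ a ^ (q + r) + b ^ (q + r) := by
  have h1 : 0 ≤ (|a| ^ q - |b| ^ q) * (|a| ^ r - |b| ^ r) := by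
    rcases le_total |a| |b| with hab | hab
    · exact mul_nonneg_of_nonpos_of_nonpos
        (sub_nonpos.2 (pow_le_pow_left₀ (abs_nonneg _) hab _))
        (sub_nonpos.2 (pow_le_pow_left₀ (abs_nonneg _) hab _))
    · exact mul_nonneg (sub_nonneg.2 (pow_le_pow_left₀ (abs_nonneg _) hab _))
        (sub_nonneg.2 (pow_le_pow_left₀ (abs_nonneg _) hab _))
  have h2 : a ^ q * b ^ r ≤ |a| ^ q * |b| ^ r := by
    rw [← abs_pow, ← abs_pow, ← abs_mul]; exact le_abs_self _
  have h3 : b ^ q * a ^ r ≤ |b| ^ q * |a| ^ r := by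
    rw [← abs_pow, ← abs_pow, ← abs_mul]; exact le_abs_self _
  rw [← h.pow_abs a, ← h.pow_abs b, pow_add, pow_add]
  nlinarith

lemma trace_mul_diagonal_mul_diagonal (X : Matrix V V ℝ) (a b : V → ℝ) :
    (X * diagonal a * X * diagonal b).trace = ∑ i, ∑ j, X i j * X j i * (a j * b i) := by
  simp only [trace, diag_apply, mul_diagonal]
  refine Finset.sum_congr rfl fun i _ => ?_
  rw [mul_apply, Finset.sum_mul]
  simp only [mul_diagonal]
  exact Finset.sum_congr rfl fun j _ => by ring

/-- In an eigenbasis of `Y`, the trace is a combination of products `λⱼ^q λᵢ^r`, which the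
rearrangement inequality replaces by pure powers. The weights are the squared entries of the rotated
contraction, whose columns have length at most one. -/
lemma trace_mul_pow_mul_mul_pow_le {X Y : Matrix V V ℝ} (hX : Xᵀ = X) (hXc : IsContraction X)
    (hY : Yᵀ = Y) (q r : ℕ) (h : Even (q + r)) :
    (X * Y ^ q * X * Y ^ r).trace ≤ (Y ^ (q + r)).trace := by
  obtain ⟨U, d, h1, h2, hp⟩ := exists_orthogonal_diagonalization hY
  set Z := Uᵀ * X * U with hZ
  have hZt : Zᵀ = Z := by simp [hZ, transpose_mul, hX, Matrix.mul_assoc]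
  have hZs : ∀ i j, Z i j = Z j i := fun i j => by conv_lhs => rw [← hZt, transpose_apply]
  have e1 : (X * Y ^ q * X * Y ^ r).trace
      = (Z * diagonal (fun i => d i ^ q) * Z * diagonal (fun i => d i ^ r)).trace := by
    rw [hp, hp, hZ]
    simp only [Matrix.mul_assoc]
    rw [trace_mul_comm Uᵀ]
    simp only [Matrix.mul_assoc]
  have e2 : (Y ^ (q + r)).trace = ∑ i, d i ^ (q + r) := by
    rw [hp, trace_mul_comm, ← Matrix.mul_assoc, h1, Matrix.one_mul, trace_diagonal]
  have hcol : ∀ j, ∑ i, Z i j * Z i j ≤ 1 := by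
    intro j
    have g0 : ∀ x : V → ℝ, (Uᵀ *ᵥ x) ⬝ᵥ (Uᵀ *ᵥ x) = x ⬝ᵥ x := by
      intro x
      rw [dotProduct_mulVec, vecMul_mulVec, transpose_transpose, h2, vecMul_one]
    have g1 : ∀ x : V → ℝ, (U *ᵥ x) ⬝ᵥ (U *ᵥ x) = x ⬝ᵥ x := by
      intro x
      rw [dotProduct_mulVec, vecMul_mulVec, h1, vecMul_one]
    have g2 : (Z *ᵥ Pi.single j 1) ⬝ᵥ (Z *ᵥ Pi.single j 1) = ∑ i, Z i j * Z i j := by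
      simp [dotProduct]
    rw [← g2, hZ, ← mulVec_mulVec, ← mulVec_mulVec, g0]
    refine (hXc _).trans ?_
    rw [g1]
    simp
  rw [e1, e2, trace_mul_diagonal_mul_diagonal]
  have hsw : ∑ i, ∑ j, Z i j * Z j i * (d j ^ q * d i ^ r)
      = ∑ i, ∑ j, Z i j * Z j i * (d i ^ q * d j ^ r) := by
    rw [Finset.sum_comm]
    exact Finset.sum_congr rfl fun i _ => Finset.sum_congr rfl fun j _ => by ring
  have hA : ∑ i, ∑ j, Z i j * Z i j * d j ^ (q + r) ≤ ∑ i, d i ^ (q + r) := by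
    rw [Finset.sum_comm]
    refine Finset.sum_le_sum fun j _ => ?_
    rw [← Finset.sum_mul]
    exact mul_le_of_le_one_left (h.pow_nonneg _) (hcol j)
  have hA' : ∑ i, ∑ j, Z i j * Z i j * d i ^ (q + r) ≤ ∑ i, d i ^ (q + r) := by
    refine le_trans (le_of_eq ?_) hA
    rw [Finset.sum_comm]
    exact Finset.sum_congr rfl fun i _ => Finset.sum_congr rfl fun j _ => by rw [hZs]
  have hB : ∑ i, ∑ j, Z i j * Z j i * (d j ^ q * d i ^ r)
      + ∑ i, ∑ j, Z i j * Z j i * (d i ^ q * d j ^ r)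
      ≤ ∑ i, ∑ j, Z i j * Z i j * d i ^ (q + r) + ∑ i, ∑ j, Z i j * Z i j * d j ^ (q + r) := by
    simp only [← Finset.sum_add_distrib]
    refine Finset.sum_le_sum fun i _ => Finset.sum_le_sum fun j _ => ?_
    rw [hZs j i, ← mul_add, ← mul_add]
    refine mul_le_mul_of_nonneg_left ?_ (mul_self_nonneg _)
    have := pow_mul_pow_add_le (a := d i) (b := d j) q r h
    linarith
  linarith

section Deriv

lemma hasDerivAt_add_smul_pow {𝔸 : Type*} [NormedRing 𝔸] [NormedAlgebra ℝ 𝔸] (H X : 𝔸) (n : ℕ)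
    (t : ℝ) : HasDerivAt (fun t : ℝ => (H + t • X) ^ n)
      (∑ i ∈ Finset.range n, (H + t • X) ^ i * X * (H + t • X) ^ (n - 1 - i)) t := by
  have hY : HasDerivAt (fun t : ℝ => H + t • X) X t := by
    have := ((hasDerivAt_id t).smul_const X).const_add H
    rwa [one_smul] at this
  induction n with
  | zero => simpa using hasDerivAt_const t (1 : 𝔸)
  | succ n ih =>
    have := ih.mul hY
    convert! this using 1
    · funext t
      exact pow_succ _ _
    · rw [Finset.sum_range_succ, Finset.sum_mul]
      congr 1
      · refine Finset.sum_congr rfl fun i hi => ?_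
        rw [mul_assoc (_ * X), ← pow_succ]
        congr 2
        have := Finset.mem_range.1 hi
        omega
      · simp

/-- Stated for a linear functional, so that no norm appears in the conclusion. -/
lemma hasDerivAt_linearMap_mul_add_smul_pow {𝔸 : Type*} [NormedRing 𝔸] [NormedAlgebra ℝ 𝔸]
    [FiniteDimensional ℝ 𝔸] (L : 𝔸 →ₗ[ℝ] ℝ) (Z H X : 𝔸) (n : ℕ) (t : ℝ) :
    HasDerivAt (fun t : ℝ => L (Z * (H + t • X) ^ n))
      (L (Z * ∑ i ∈ Finset.range n, (H + t • X) ^ i * X * (H + t • X) ^ (n - 1 - i))) t :=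
  (LinearMap.toContinuousLinearMap L).hasFDerivAt.comp_hasDerivAt t
    ((hasDerivAt_add_smul_pow H X n t).const_mul Z)

attribute [local instance] Matrix.linftyOpNormedRing Matrix.linftyOpNormedAlgebra in
lemma hasDerivAt_trace_mul_add_smul_pow (Z H X : Matrix V V ℝ) (n : ℕ) (t : ℝ) :
    HasDerivAt (fun t : ℝ => (Z * (H + t • X) ^ n).trace)
      ((Z * ∑ i ∈ Finset.range n, (H + t • X) ^ i * X * (H + t • X) ^ (n - 1 - i)).trace) t :=
  hasDerivAt_linearMap_mul_add_smul_pow (traceLinearMap V ℝ ℝ) Z H X n t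

lemma hasDerivAt_trace_pow (H X : Matrix V V ℝ) (n : ℕ) (t : ℝ) :
    HasDerivAt (fun t : ℝ => ((H + t • X) ^ (n + 1)).trace)
      ((n + 1) * (X * (H + t • X) ^ n).trace) t := by
  have := hasDerivAt_trace_mul_add_smul_pow 1 H X (n + 1) t
  simp only [Matrix.one_mul] at this
  convert! this using 1
  rw [trace_sum, Finset.sum_congr rfl (g := fun _ => (X * (H + t • X) ^ n).trace)]
  · simp
  · intro i hi
    have := Finset.mem_range.1 hi
    rw [Matrix.mul_assoc, trace_mul_comm, Matrix.mul_assoc, ← pow_add]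
    congr 3
    omega

lemma hasDerivAt_trace_mul_pow (H X : Matrix V V ℝ) (n : ℕ) (t : ℝ) :
    HasDerivAt (fun t : ℝ => (X * (H + t • X) ^ n).trace)
      (∑ i ∈ Finset.range n, (X * (H + t • X) ^ i * X * (H + t • X) ^ (n - 1 - i)).trace) t := by
  convert! hasDerivAt_trace_mul_add_smul_pow X H X n t using 1
  rw [Finset.mul_sum, trace_sum]
  simp only [Matrix.mul_assoc]

end Deriv

/-- The term of order `p` in the Cauchy product of the power series of `cosh t` with the sequence
`h`. It equals `h p` at `t = 0`, and its second derivative in `t` is the term of order `p - 1`. -/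
noncomputable def coshPoly (h : ℕ → ℝ) (p : ℕ) (t : ℝ) : ℝ :=
  ∑ m ∈ Finset.range (p + 1), t ^ (2 * m) / (2 * m).factorial * h (p - m)

lemma hasDerivAt_pow_div_factorial (n : ℕ) (t : ℝ) :
    HasDerivAt (fun t : ℝ => t ^ (n + 1) / (n + 1).factorial) (t ^ n / n.factorial) t := by
  convert! (hasDerivAt_pow (n + 1) t).div_const ((n + 1).factorial : ℝ) using 1
  rw [Nat.factorial_succ]
  push_cast
  field_simp

lemma hasDerivAt_coshPoly_succ (h : ℕ → ℝ) (p : ℕ) (t : ℝ) :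
    HasDerivAt (coshPoly h (p + 1))
      (∑ m ∈ Finset.range (p + 1), t ^ (2 * m + 1) / (2 * m + 1).factorial * h (p - m)) t := by
  have e : coshPoly h (p + 1) = fun t => ∑ m ∈ Finset.range (p + 1),
      t ^ (2 * m + 1 + 1) / (2 * m + 1 + 1).factorial * h (p - m) + h (p + 1) := by
    funext t
    rw [coshPoly, Finset.sum_range_succ']
    simp [mul_add, add_assoc]
  rw [e]
  exact (HasDerivAt.fun_sum fun m _ =>
    (hasDerivAt_pow_div_factorial (2 * m + 1) t).mul_const _).add_const _

lemma hasDerivAt_coshPoly_deriv (h : ℕ → ℝ) (p : ℕ) (t : ℝ) :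
    HasDerivAt (fun t => ∑ m ∈ Finset.range (p + 1),
      t ^ (2 * m + 1) / (2 * m + 1).factorial * h (p - m)) (coshPoly h p t) t :=
  HasDerivAt.fun_sum fun m _ => (hasDerivAt_pow_div_factorial (2 * m) t).mul_const _

lemma nonneg_of_hasDerivAt_of_nonneg {f f' f'' : ℝ → ℝ} (h1 : ∀ t, HasDerivAt f (f' t) t)
    (h2 : ∀ t, HasDerivAt f' (f'' t) t) (h3 : ∀ t, 0 ≤ f'' t) (h0 : f 0 = 0) (h0' : f' 0 = 0)
    (t : ℝ) : 0 ≤ f t := by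
  have hm : Monotone f' := monotone_of_hasDerivAt_nonneg h2 h3
  rcases lt_trichotomy t 0 with ht | ht | ht
  · obtain ⟨c, hc, e⟩ := exists_hasDerivAt_eq_slope f f' ht
      (fun x _ => (h1 x).continuousAt.continuousWithinAt) fun x _ => h1 x
    have : f' c ≤ 0 := by rw [← h0']; exact hm hc.2.le
    rw [e, h0, div_nonpos_iff] at this
    rcases this with h | h <;> linarith
  · rw [ht, h0]
  · obtain ⟨c, hc, e⟩ := exists_hasDerivAt_eq_slope f f' ht
      (fun x _ => (h1 x).continuousAt.continuousWithinAt) fun x _ => h1 x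
    have : 0 ≤ f' c := by rw [← h0']; exact hm hc.1.le
    rw [e, h0, div_nonneg_iff] at this
    rcases this with h | h <;> linarith

/-- The normalized even trace moment, a Taylor coefficient of `tr cosh Y`. -/
noncomputable def evenMoment (Y : Matrix V V ℝ) (p : ℕ) : ℝ :=
  (Y ^ (2 * p)).trace / (2 * p).factorial

/-- The even part in `t` of the trace moments of `H + t X` is dominated by the Taylor coefficients
of `cosh t · tr cosh H`. The difference vanishes to second order at `0`, and its second derivative
is at least the difference of the next lower order. -/
lemma evenMoment_add_evenMoment_le {H X : Matrix V V ℝ} (hH : Hᵀ = H) (hX : Xᵀ = X)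
    (hXc : IsContraction X) (p : ℕ) (t : ℝ) :
    evenMoment (H + t • X) p + evenMoment (H + t • (-X)) p
      ≤ 2 * coshPoly (evenMoment H) p t := by
  induction p generalizing t with
  | zero => simp [evenMoment, coshPoly]; linarith
  | succ p ih =>
    have d1 : ∀ (Z : Matrix V V ℝ) (t : ℝ), HasDerivAt (fun t => evenMoment (H + t • Z) (p + 1))
        ((Z * (H + t • Z) ^ (2 * p + 1)).trace / (2 * p + 1).factorial) t := by
      intro Z t
      convert! (hasDerivAt_trace_pow H Z (2 * p + 1) t).div_const
        ((2 * p + 1 + 1).factorial : ℝ) using 1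
      rw [Nat.factorial_succ (2 * p + 1)]
      push_cast
      field_simp
    have d2 : ∀ (Z : Matrix V V ℝ) (t : ℝ),
        HasDerivAt (fun t => (Z * (H + t • Z) ^ (2 * p + 1)).trace / (2 * p + 1).factorial)
          ((∑ i ∈ Finset.range (2 * p + 1), (Z * (H + t • Z) ^ i * Z
            * (H + t • Z) ^ (2 * p + 1 - 1 - i)).trace) / (2 * p + 1).factorial) t :=
      fun Z t => (hasDerivAt_trace_mul_pow H Z (2 * p + 1) t).div_const _
    have b2 : ∀ (Z : Matrix V V ℝ) (t : ℝ), Zᵀ = Z → IsContraction Z →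
        (∑ i ∈ Finset.range (2 * p + 1), (Z * (H + t • Z) ^ i * Z
            * (H + t • Z) ^ (2 * p + 1 - 1 - i)).trace) / (2 * p + 1).factorial
          ≤ evenMoment (H + t • Z) p := by
      intro Z t hZ hZc
      have hY : (H + t • Z)ᵀ = H + t • Z := by rw [transpose_add, transpose_smul, hH, hZ]
      have hle : ∑ i ∈ Finset.range (2 * p + 1), (Z * (H + t • Z) ^ i * Z
            * (H + t • Z) ^ (2 * p + 1 - 1 - i)).trace
          ≤ ∑ i ∈ Finset.range (2 * p + 1), ((H + t • Z) ^ (2 * p)).trace := by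
        refine Finset.sum_le_sum fun i hi => ?_
        have hi' := Finset.mem_range.1 hi
        have e : i + (2 * p + 1 - 1 - i) = 2 * p := by omega
        have := trace_mul_pow_mul_mul_pow_le hZ hZc hY i (2 * p + 1 - 1 - i)
          (by rw [e]; exact even_two_mul p)
        rwa [e] at this
      rw [Finset.sum_const, Finset.card_range, nsmul_eq_mul] at hle
      rw [evenMoment, Nat.factorial_succ (2 * p), div_le_div_iff₀ (by positivity) (by positivity)]
      have hf : (0 : ℝ) < (2 * p).factorial := by positivity
      push_cast at hle ⊢
      nlinarith
    have key := nonneg_of_hasDerivAt_of_nonneg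
      (fun t => ((hasDerivAt_coshPoly_succ (evenMoment H) p t).const_mul 2).sub
        ((d1 X t).add (d1 (-X) t)))
      (fun t => ((hasDerivAt_coshPoly_deriv (evenMoment H) p t).const_mul 2).sub
        ((d2 X t).add (d2 (-X) t)))
      (fun t => by
        have h1 := b2 X t hX hXc
        have h2 := b2 (-X) t (by rw [transpose_neg, hX]) hXc.neg
        have h3 := ih t
        linarith)
      (by
        simp only [Pi.sub_apply, Pi.add_apply, coshPoly, zero_smul, add_zero]
        rw [Finset.sum_range_succ', Finset.sum_eq_zero (fun m _ => by simp)]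
        simp
        ring)
      (by simp [neg_div]) t
    simp only [Pi.sub_apply, Pi.add_apply] at key
    linarith

lemma evenMoment_nonneg {Y : Matrix V V ℝ} (hY : Yᵀ = Y) (p : ℕ) : 0 ≤ evenMoment Y p := by
  obtain ⟨U, d, h1, -, hp⟩ := exists_orthogonal_diagonalization hY
  refine div_nonneg ?_ (by positivity)
  rw [hp, trace_mul_comm, ← Matrix.mul_assoc, h1, Matrix.one_mul, trace_diagonal]
  exact Finset.sum_nonneg fun i _ => (even_two_mul p).pow_nonneg _

end TraceMoments

/-! ### Concentration of Gaussian matrix series -/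

/-- The trace of `cosh Y`, as the sum of its power series. With values in `[0, ∞]` no
convergence has to be discussed. -/
noncomputable def coshTrace (Y : Matrix V V ℝ) : ℝ≥0∞ := ∑' p, ENNReal.ofReal (evenMoment Y p)

lemma tsum_ofReal_pow_div_factorial (t : ℝ) :
    ∑' m : ℕ, ENNReal.ofReal (t ^ (2 * m) / (2 * m).factorial) = ENNReal.ofReal (Real.cosh t) := by
  rw [← ENNReal.ofReal_tsum_of_nonneg, (Real.hasSum_cosh t).tsum_eq]
  · exact fun m => div_nonneg ((even_two_mul m).pow_nonneg t) (by positivity)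
  · exact (Real.hasSum_cosh t).summable

lemma coshTrace_zero : coshTrace (0 : Matrix V V ℝ) = Fintype.card V := by
  rw [coshTrace, tsum_eq_single 0]
  · simp [evenMoment]
  · intro p hp
    simp [evenMoment, hp]

/-- The step of the Laplace transform method: averaging over `± t X` costs at most the scalar factor
`cosh t`. -/
lemma coshTrace_add_coshTrace_le {H X : Matrix V V ℝ} (hH : Hᵀ = H) (hX : Xᵀ = X)
    (hXc : IsContraction X) (t : ℝ) :
    coshTrace (H + t • X) + coshTrace (H + t • (-X))
      ≤ 2 * (ENNReal.ofReal (Real.cosh t) * coshTrace H) := by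
  have hsym : ∀ Z : Matrix V V ℝ, Zᵀ = Z → (H + t • Z)ᵀ = H + t • Z := fun Z hZ => by
    rw [transpose_add, transpose_smul, hH, hZ]
  have hXn : (-X)ᵀ = -X := by rw [transpose_neg, hX]
  have hprod : ENNReal.ofReal (Real.cosh t) * coshTrace H
      = ∑' p, ∑ x ∈ Finset.HasAntidiagonal.antidiagonal p,
        ENNReal.ofReal (t ^ (2 * x.1) / (2 * x.1).factorial)
          * ENNReal.ofReal (evenMoment H x.2) := by
    rw [← tsum_ofReal_pow_div_factorial, coshTrace, ← ENNReal.tsum_mul_right]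
    simp_rw [← ENNReal.tsum_mul_left]
    rw [← ENNReal.tsum_prod, ← Finset.HasAntidiagonal.sigmaAntidiagonalEquivProd.tsum_eq,
      ENNReal.tsum_sigma']
    refine tsum_congr fun p => ?_
    rw [tsum_fintype]
    simp only [Finset.HasAntidiagonal.sigmaAntidiagonalEquivProd_apply]
    exact Finset.sum_coe_sort (Finset.HasAntidiagonal.antidiagonal p) fun x : ℕ × ℕ =>
      ENNReal.ofReal (t ^ (2 * x.1) / (2 * x.1).factorial) * ENNReal.ofReal (evenMoment H x.2)
  rw [hprod, coshTrace, coshTrace, ← ENNReal.tsum_add, ← ENNReal.tsum_mul_left]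
  refine ENNReal.tsum_le_tsum fun p => ?_
  rw [← ENNReal.ofReal_add (evenMoment_nonneg (hsym X hX) p) (evenMoment_nonneg (hsym _ hXn) p)]
  refine (ENNReal.ofReal_le_ofReal (evenMoment_add_evenMoment_le hH hX hXc p t)).trans ?_
  have hnn : ∀ m : ℕ, 0 ≤ t ^ (2 * m) / (2 * m).factorial := fun m =>
    div_nonneg ((even_two_mul m).pow_nonneg t) (by positivity)
  rw [ENNReal.ofReal_mul zero_le_two, coshPoly, ← Finset.Nat.sum_antidiagonal_eq_sum_range_succ
    (fun i j => t ^ (2 * i) / (2 * i).factorial * evenMoment H j),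
    ENNReal.ofReal_sum_of_nonneg
      (fun x _ => mul_nonneg (hnn x.1) (evenMoment_nonneg hH x.2))]
  simp only [ENNReal.ofReal_mul (hnn _), ENNReal.ofReal_ofNat, le_refl]

/-- A symmetric matrix of operator norm above `a` has an eigenvalue of modulus above `a`, which
alone contributes `cosh a` to the trace. -/
lemma ofReal_cosh_le_coshTrace {Y : Matrix V V ℝ} (hY : Yᵀ = Y) {a : ℝ} (ha : 0 ≤ a)
    (h : ¬ ∀ x, (Y *ᵥ x) ⬝ᵥ (Y *ᵥ x) ≤ a ^ 2 * (x ⬝ᵥ x)) :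
    ENNReal.ofReal (Real.cosh a) ≤ coshTrace Y := by
  obtain ⟨U, d, h1, h2, hp⟩ := exists_orthogonal_diagonalization hY
  have hex : ∃ i, a < |d i| := by
    by_contra! hcon
    refine h fun x => ?_
    set z := Uᵀ *ᵥ x with hz
    have g : z ⬝ᵥ z = x ⬝ᵥ x := by
      rw [hz, dotProduct_mulVec, vecMul_mulVec, transpose_transpose, h2, vecMul_one]
    have e : (Y *ᵥ x) ⬝ᵥ (Y *ᵥ x) = ∑ i, d i ^ 2 * (z i * z i) := by
      rw [dotProduct_mulVec, vecMul_mulVec, hY, ← dotProduct_mulVec, ← sq, hp, ← mulVec_mulVec,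
        ← mulVec_mulVec, dotProduct_mulVec, ← mulVec_transpose, ← hz, dotProduct]
      refine Finset.sum_congr rfl fun i _ => ?_
      rw [mulVec_diagonal]; ring
    rw [e, ← g, dotProduct, Finset.mul_sum]
    refine Finset.sum_le_sum fun i _ => mul_le_mul_of_nonneg_right ?_ (mul_self_nonneg _)
    rw [← sq_abs]
    exact pow_le_pow_left₀ (abs_nonneg _) (hcon i) 2
  obtain ⟨i, hi⟩ := hex
  rw [← tsum_ofReal_pow_div_factorial, coshTrace]
  refine ENNReal.tsum_le_tsum fun p => ENNReal.ofReal_le_ofReal ?_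
  rw [evenMoment, hp, trace_mul_comm, ← Matrix.mul_assoc, h1, Matrix.one_mul, trace_diagonal]
  refine div_le_div_of_nonneg_right ?_ (by positivity)
  calc a ^ (2 * p) ≤ |d i| ^ (2 * p) := pow_le_pow_left₀ ha hi.le _
    _ = d i ^ (2 * p) := (even_two_mul p).pow_abs _
    _ ≤ ∑ j, d j ^ (2 * p) := Finset.single_le_sum (f := fun j => d j ^ (2 * p))
        (fun j _ => (even_two_mul p).pow_nonneg _) (Finset.mem_univ i)

lemma measurable_coshTrace {α : Type*} [MeasurableSpace α] {f : α → Matrix V V ℝ}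
    (hf : ∀ i j, Measurable fun x => f x i j) : Measurable fun x => coshTrace (f x) := by
  have hpow : ∀ (n : ℕ) i j, Measurable fun x => (f x ^ n) i j := by
    intro n
    induction n with
    | zero => intro i j; simp only [pow_zero]; exact measurable_const
    | succ n ih =>
      intro i j
      simp only [pow_succ, mul_apply]
      exact Finset.measurable_sum _ fun k _ => (ih i k).mul (hf k j)
  unfold coshTrace evenMoment trace
  refine Measurable.tsum fun p => ENNReal.measurable_ofReal.comp ?_
  exact (Finset.measurable_sum _ fun i _ => hpow _ i i).div_const _

section Gaussian

lemma lintegral_cosh_gaussianReal (v : ℝ≥0) (θ : ℝ) :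
    ∫⁻ y, ENNReal.ofReal (Real.cosh (θ * y)) ∂(gaussianReal 0 v)
      = ENNReal.ofReal (Real.exp (v * θ ^ 2 / 2)) := by
  have hi : ∀ c : ℝ, Integrable (fun y => Real.exp (c * y)) (gaussianReal 0 v) :=
    fun c => integrable_exp_mul_gaussianReal c
  have hm : ∀ c : ℝ, ∫ y, Real.exp (c * y) ∂(gaussianReal 0 v) = Real.exp (v * c ^ 2 / 2) := by
    intro c
    have := congrFun (mgf_id_gaussianReal (μ := 0) (v := v)) c
    simpa [mgf] using this
  have e : (fun y => Real.cosh (θ * y))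
      = fun y => (Real.exp (θ * y) + Real.exp ((-θ) * y)) / 2 := by
    funext y; rw [Real.cosh_eq, neg_mul]
  rw [← ofReal_integral_eq_lintegral_ofReal]
  · rw [e, integral_div, integral_add (hi _) (hi _), hm, hm]
    congr 1
    rw [neg_sq]; ring
  · rw [e]; exact ((hi _).add (hi _)).div_const 2
  · exact Filter.Eventually.of_forall fun y => (Real.cosh_pos _).le

/-- Adding an independent Gaussian multiple of a contraction increases the expected `tr cosh` at
most by the factor of the scalar case. By symmetry of the Gaussian law one may average over
`± X`. -/
lemma lintegral_coshTrace_gaussianReal_le {H X : Matrix V V ℝ} (hH : Hᵀ = H) (hX : Xᵀ = X)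
    (hXc : IsContraction X) (v : ℝ≥0) (θ : ℝ) :
    ∫⁻ y, coshTrace (H + (θ * y) • X) ∂(gaussianReal 0 v)
      ≤ ENNReal.ofReal (Real.exp (v * θ ^ 2 / 2)) * coshTrace H := by
  have hmeas : ∀ Z : Matrix V V ℝ, Measurable fun y : ℝ => coshTrace (H + (θ * y) • Z) := by
    intro Z
    refine measurable_coshTrace fun i j => ?_
    simp only [Matrix.add_apply, Matrix.smul_apply, smul_eq_mul]
    fun_prop
  have hneg : ∫⁻ y, coshTrace (H + (θ * y) • X) ∂(gaussianReal 0 v)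
      = ∫⁻ y, coshTrace (H + (θ * y) • (-X)) ∂(gaussianReal 0 v) := by
    have h0 := gaussianReal_map_neg (μ := 0) (v := v)
    rw [neg_zero] at h0
    conv_lhs => rw [← h0]
    rw [lintegral_map (hmeas X) measurable_neg]
    simp
  have h2 : 2 * ∫⁻ y, coshTrace (H + (θ * y) • X) ∂(gaussianReal 0 v)
      ≤ 2 * (ENNReal.ofReal (Real.exp (v * θ ^ 2 / 2)) * coshTrace H) := by
    rw [two_mul]
    nth_rw 2 [hneg]
    rw [← lintegral_add_left (hmeas X)]
    refine (lintegral_mono fun y => coshTrace_add_coshTrace_le hH hX hXc (θ * y)).trans ?_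
    rw [lintegral_const_mul' _ _ (by simp), lintegral_mul_const, lintegral_cosh_gaussianReal]
    exact ENNReal.measurable_ofReal.comp (Real.measurable_cosh.comp (measurable_const_mul θ))
  exact (ENNReal.mul_le_mul_iff_right (by simp) (by simp)).1 h2

variable {Ω ι : Type*} [MeasurableSpace Ω] {μ : Measure Ω} [IsProbabilityMeasure μ]

/-- The `tr cosh` transform of a Gaussian matrix series, bounded by peeling off one independent
summand at a time. -/
lemma lintegral_coshTrace_sum_le {η : ι → Ω → ℝ} {v : ℝ≥0} (hη : ∀ i, Measurable (η i))
    (hlaw : ∀ i, μ.map (η i) = gaussianReal 0 v) (hind : iIndepFun η μ)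
    {X : ι → Matrix V V ℝ} (hX : ∀ i, (X i)ᵀ = X i) (hXc : ∀ i, IsContraction (X i)) (θ : ℝ)
    (t : Finset ι) :
    ∫⁻ ω, coshTrace (∑ i ∈ t, (θ * η i ω) • X i) ∂μ
      ≤ ENNReal.ofReal (Real.exp (v * θ ^ 2 / 2)) ^ t.card * Fintype.card V := by
  classical
  induction t using Finset.induction_on with
  | empty => simp [coshTrace_zero]
  | insert i t hi ih =>
    let Z : Ω → (t → ℝ) := fun ω j => η j ω
    let H : (t → ℝ) → Matrix V V ℝ := fun z => ∑ j : t, (θ * z j) • X j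
    have hZ : Measurable Z := measurable_pi_lambda _ fun j => hη j
    have hHt : ∀ z, (H z)ᵀ = H z := by
      intro z
      simp [H, transpose_sum, hX]
    have hHm : ∀ k l, Measurable fun z => H z k l := by
      intro k l
      simp only [H, Matrix.sum_apply, Matrix.smul_apply, smul_eq_mul]
      fun_prop
    have hHZ : ∀ ω, H (Z ω) = ∑ j ∈ t, (θ * η j ω) • X j := fun ω =>
      Finset.sum_coe_sort t fun j => (θ * η j ω) • X j
    have hZi : IndepFun Z (η i) μ :=
      (hind.indepFun_finset t {i} (by simpa using hi) hη).comp measurable_id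
        (measurable_pi_apply (⟨i, Finset.mem_singleton_self i⟩ : ({i} : Finset ι)))
    have hmap := (indepFun_iff_map_prod_eq_prod_map_map hZ.aemeasurable (hη i).aemeasurable).1 hZi
    have hΦ : Measurable fun p : (t → ℝ) × ℝ => coshTrace (H p.1 + (θ * p.2) • X i) := by
      refine measurable_coshTrace fun k l => ?_
      simp only [Matrix.add_apply, Matrix.smul_apply, smul_eq_mul]
      exact ((hHm k l).comp measurable_fst).add ((measurable_snd.const_mul θ).mul_const _)
    calc ∫⁻ ω, coshTrace (∑ j ∈ insert i t, (θ * η j ω) • X j) ∂μ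
        = ∫⁻ ω, coshTrace (H (Z ω) + (θ * η i ω) • X i) ∂μ := by
          refine lintegral_congr fun ω => ?_
          rw [Finset.sum_insert hi, hHZ, add_comm]
      _ = ∫⁻ p, coshTrace (H p.1 + (θ * p.2) • X i) ∂(μ.map fun ω => (Z ω, η i ω)) :=
          (lintegral_map hΦ (hZ.prodMk (hη i))).symm
      _ = ∫⁻ z, ∫⁻ y, coshTrace (H z + (θ * y) • X i) ∂(gaussianReal 0 v) ∂(μ.map Z) := by
          rw [hmap, hlaw, lintegral_prod _ hΦ.aemeasurable]
      _ ≤ ∫⁻ z, ENNReal.ofReal (Real.exp (v * θ ^ 2 / 2)) * coshTrace (H z) ∂(μ.map Z) :=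
          lintegral_mono fun z => lintegral_coshTrace_gaussianReal_le (hHt z) (hX i) (hXc i) v θ
      _ = ENNReal.ofReal (Real.exp (v * θ ^ 2 / 2))
            * ∫⁻ ω, coshTrace (∑ j ∈ t, (θ * η j ω) • X j) ∂μ := by
          rw [lintegral_const_mul' _ _ (by simp), lintegral_map (measurable_coshTrace hHm) hZ]
          simp only [hHZ]
      _ ≤ _ := by
          rw [Finset.card_insert_of_notMem hi, pow_succ' (ENNReal.ofReal _) t.card, mul_assoc]
          gcongr

/-- The Gaussian tail of a matrix series, for an event in terms of `coshTrace`. The parameter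
`θ = √(2 L / N) / σ₀` optimizes the exponential Markov inequality, and `cosh (2 L) ≥ exp (2 L) / 2`
accounts for the factor `2` in `δ`. -/
lemma measure_cosh_le_coshTrace_le {N : ℕ} (hN : 0 < N) {η : Fin N → Ω → ℝ} {v : ℝ≥0}
    (hη : ∀ i, Measurable (η i)) (hlaw : ∀ i, μ.map (η i) = gaussianReal 0 v)
    (hind : iIndepFun η μ) {σ₀ : ℝ} (hσ₀ : 0 < σ₀) (hv : (v : ℝ) ≤ σ₀ ^ 2)
    {X : Fin N → Matrix V V ℝ} (hX : ∀ i, (X i)ᵀ = X i) (hXc : ∀ i, IsContraction (X i))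
    {δ L : ℝ} (hL : 0 < L) (hδ : 2 * Fintype.card V * Real.exp (-L) = δ) :
    μ {ω | ENNReal.ofReal (Real.cosh (2 * L))
        ≤ coshTrace (∑ i, (√(2 * L / N) / σ₀ * η i ω) • X i)} ≤ ENNReal.ofReal δ := by
  set θ := √(2 * L / N) / σ₀ with hθ
  have hN' : (0 : ℝ) < N := by exact_mod_cast hN
  have hmeas : Measurable fun ω => coshTrace (∑ i, (θ * η i ω) • X i) := by
    refine measurable_coshTrace fun k l => ?_
    simp only [Matrix.sum_apply, Matrix.smul_apply, smul_eq_mul]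
    fun_prop
  have h1 := mul_meas_ge_le_lintegral (μ := μ) hmeas (ENNReal.ofReal (Real.cosh (2 * L)))
  have h2 := lintegral_coshTrace_sum_le hη hlaw hind hX hXc θ Finset.univ
  have hexp : Real.exp (v * θ ^ 2 / 2) ^ N ≤ Real.exp L := by
    rw [← Real.exp_nat_mul, Real.exp_le_exp, hθ, div_pow, Real.sq_sqrt (by positivity)]
    calc (N : ℝ) * (v * (2 * L / N / σ₀ ^ 2) / 2) = v * (L / σ₀ ^ 2) := by field_simp
      _ ≤ σ₀ ^ 2 * (L / σ₀ ^ 2) := by gcongr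
      _ = L := by field_simp
  have h3 : ENNReal.ofReal (Real.exp (v * θ ^ 2 / 2)) ^ (Finset.univ : Finset (Fin N)).card
      * Fintype.card V ≤ ENNReal.ofReal (Real.cosh (2 * L)) * ENNReal.ofReal δ := by
    rw [Finset.card_univ, Fintype.card_fin, ← ENNReal.ofReal_pow (Real.exp_pos _).le,
      ← ENNReal.ofReal_natCast, ← ENNReal.ofReal_mul (by positivity),
      ← ENNReal.ofReal_mul (Real.cosh_pos _).le]
    refine ENNReal.ofReal_le_ofReal ?_
    have hc : Real.exp (2 * L) / 2 ≤ Real.cosh (2 * L) := by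
      rw [Real.cosh_eq]; have := Real.exp_pos (-(2 * L)); linarith
    have hδ0 : 0 ≤ δ := by rw [← hδ]; positivity
    calc Real.exp (v * θ ^ 2 / 2) ^ N * Fintype.card V ≤ Real.exp L * Fintype.card V := by gcongr
      _ = Real.exp (2 * L) / 2 * δ := by
          rw [← hδ, show Real.exp L = Real.exp (2 * L) * Real.exp (-L) by
            rw [← Real.exp_add]; congr 1; ring]
          ring
      _ ≤ _ := by gcongr
  exact (ENNReal.mul_le_mul_iff_right (by simpa using Real.cosh_pos (2 * L)) (by simp)).1
    ((h1.trans h2).trans h3)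

/-- An event of probability at most `ε` for each fixed value of an independent finite-valued
random variable has probability at most `ε` for its random value. -/
lemma measure_mem_le_of_indepFun {α β : Type*} [Fintype α] [MeasurableSpace α]
    [MeasurableSingletonClass α] [MeasurableSpace β] {A : Ω → α} {B : Ω → β}
    (hA : Measurable A) (hAB : IndepFun A B μ) {E : α → Set β}
    (hE : ∀ x, MeasurableSet (E x)) {ε : ℝ≥0∞} (h : ∀ x, μ {ω | B ω ∈ E x} ≤ ε) :
    μ {ω | B ω ∈ E (A ω)} ≤ ε := by
  have hsub : {ω | B ω ∈ E (A ω)} ⊆ ⋃ x ∈ (Finset.univ : Finset α), A ⁻¹' {x} ∩ B ⁻¹' E x := by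
    intro ω hω
    simpa using hω
  calc μ {ω | B ω ∈ E (A ω)} ≤ ∑ x, μ (A ⁻¹' {x} ∩ B ⁻¹' E x) :=
        (measure_mono hsub).trans (measure_biUnion_finset_le _ _)
    _ = ∑ x, μ (A ⁻¹' {x}) * μ (B ⁻¹' E x) := Finset.sum_congr rfl fun x _ =>
        hAB.measure_inter_preimage_eq_mul _ _ (measurableSet_singleton x) (hE x)
    _ ≤ ∑ x, μ (A ⁻¹' {x}) * ε := Finset.sum_le_sum fun x _ => by gcongr; exact h x
    _ = ε := by
        rw [← Finset.sum_mul, sum_measure_preimage_singleton _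
          fun x _ => hA (measurableSet_singleton x)]
        simp

/-- The matrix Gaussian tail bound for a random design that is independent of the noise. -/
lemma measure_not_noise_bound_le {K N : ℕ} (hN : 0 < N) {η : Fin N → Ω → ℝ} {v : ℝ≥0}
    (hη : ∀ i, Measurable (η i)) (hlaw : ∀ i, μ.map (η i) = gaussianReal 0 v)
    (hind : iIndepFun η μ) {σ₀ : ℝ} (hσ₀ : 0 < σ₀) (hv : (v : ℝ) ≤ σ₀ ^ 2)
    {X : Fin K → Matrix V V ℝ} (hX : ∀ i, (X i)ᵀ = X i) (hXc : ∀ i, IsContraction (X i))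
    {arm : Ω → Fin N → Fin K} (harm : Measurable arm) (hindep : IndepFun arm (fun ω t => η t ω) μ)
    {δ L : ℝ} (hL : 0 < L) (hδ : 2 * Fintype.card V * Real.exp (-L) = δ) :
    μ {ω | ¬ ∀ x, ((∑ t, η t ω • X (arm ω t)) *ᵥ x) ⬝ᵥ ((∑ t, η t ω • X (arm ω t)) *ᵥ x)
        ≤ (σ₀ * √(2 * L * N)) ^ 2 * (x ⬝ᵥ x)} ≤ ENNReal.ofReal δ := by
  set θ := √(2 * L / N) / σ₀ with hθ
  have hN' : (0 : ℝ) < N := by exact_mod_cast hN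
  have hθpos : 0 < θ := div_pos (Real.sqrt_pos.2 (by positivity)) hσ₀
  let E : (Fin N → Fin K) → Set (Fin N → ℝ) := fun a =>
    {y | ENNReal.ofReal (Real.cosh (2 * L)) ≤ coshTrace (∑ t, (θ * y t) • X (a t))}
  have hE : ∀ a, MeasurableSet (E a) := by
    intro a
    refine measurableSet_le measurable_const (measurable_coshTrace fun k l => ?_)
    simp only [Matrix.sum_apply, Matrix.smul_apply, smul_eq_mul]
    fun_prop
  refine (measure_mono ?_).trans (measure_mem_le_of_indepFun harm hindep hE fun a =>
    measure_cosh_le_coshTrace_le hN hη hlaw hind hσ₀ hv (fun i => hX (a i)) (fun i => hXc (a i))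
      hL hδ)
  intro ω hω
  set W := ∑ t, η t ω • X (arm ω t) with hW
  have hWθ : ∑ t, (θ * η t ω) • X (arm ω t) = θ • W := by
    rw [hW, Finset.smul_sum]; simp only [mul_smul]
  have hWt : (θ • W)ᵀ = θ • W := by
    rw [transpose_smul, hW, transpose_sum]; simp only [transpose_smul, hX]
  have hval : θ * (σ₀ * √(2 * L * N)) = 2 * L := by
    have e : √(2 * L / N) * √(2 * L * N) = 2 * L := by
      rw [← Real.sqrt_mul (by positivity), show 2 * L / N * (2 * L * N) = (2 * L) ^ 2 by field_simp,
        Real.sqrt_sq (by positivity)]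
    rw [hθ]
    field_simp
    linarith
  change ENNReal.ofReal (Real.cosh (2 * L)) ≤ coshTrace (∑ t, (θ * η t ω) • X (arm ω t))
  rw [hWθ]
  refine ofReal_cosh_le_coshTrace hWt (by positivity) fun hcon => hω fun x => ?_
  have := hcon x
  rw [← hval, smul_mulVec, smul_dotProduct, dotProduct_smul, smul_eq_mul, smul_eq_mul,
    mul_pow, ← mul_assoc, ← sq, mul_assoc] at this
  exact le_of_mul_le_mul_left this (by positivity)

end Gaussian

/-! ### Error of the nuclear-norm penalized estimator -/

section Estimation
variable {s : V → ℝ}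

omit [DecidableEq V] in
lemma IsBalanced.sub {A B : Matrix V V ℝ} (hA : IsBalanced A) (hB : IsBalanced B) :
    IsBalanced (A - B) := by
  obtain ⟨hA1, a, ha⟩ := hA
  obtain ⟨hB1, b, hb⟩ := hB
  exact ⟨by rw [transpose_sub, hA1, hB1], a - b, by rw [sub_mulVec, ha, hb]; rfl⟩

omit [DecidableEq V] in
lemma isBalanced_theta (h0 : ∑ i, s i = 0) : IsBalanced (theta s) := by
  refine ⟨transpose_vecMulVec s s, 0, ?_⟩
  rw [theta, vecMulVec_mulVec]
  have : s ⬝ᵥ (fun _ => (1 : ℝ)) = 0 := by simpa [dotProduct] using h0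
  rw [this]
  ext i
  simp

/-- The basic inequality of nuclear-norm penalized least squares: when the noise matrix has
operator norm at most `a` and the penalty is `2 a / N`, the prediction error is controlled by the
two components of the estimation error. -/
lemma sum_sq_le_of_objective_le {ι : Type*} {N : ℕ} (hN : 0 < N) (hs : s ≠ 0)
    {X : ι → Matrix V V ℝ} {h : Fin N → ι × ℝ} {e : Fin N → ℝ}
    (hh : ∀ t, (h t).2 = loss s (X (h t).1) + e t) {a lam : ℝ} (ha : 0 < a)
    (hlam : lam = 2 * a / N)
    (hnoise : ∀ x, ((∑ t, e t • X (h t).1) *ᵥ x) ⬝ᵥ ((∑ t, e t • X (h t).1) *ᵥ x)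
      ≤ a ^ 2 * (x ⬝ᵥ x)) {Θ : Matrix V V ℝ}
    (hΘ : objective X lam h Θ ≤ objective X lam h (theta s)) :
    1 / (2 * (N : ℝ)) * ∑ t, traceInner (X (h t).1) (Θ - theta s) ^ 2
      ≤ lam / 2 * (3 * nuclearNorm ((Θ - theta s) - perpPart s (Θ - theta s))
        - nuclearNorm (perpPart s (Θ - theta s))) := by
  have hN' : (0 : ℝ) < N := by exact_mod_cast hN
  have hlam0 : 0 < lam := by rw [hlam]; positivity
  set Δ := Θ - theta s with hΔ
  have r1 : ∀ t, (h t).2 - traceInner (X (h t).1) Θ = e t - traceInner (X (h t).1) Δ := by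
    intro t
    rw [hh, loss, traceInner_comm, hΔ, traceInner_sub_right]; ring
  have r2 : ∀ t, (h t).2 - traceInner (X (h t).1) (theta s) = e t := by
    intro t
    rw [hh, loss, traceInner_comm]; ring
  simp only [objective, r1, r2] at hΘ
  have hlin : ∑ t, e t * traceInner (X (h t).1) Δ ≤ a * nuclearNorm Δ := by
    have := traceInner_le_mul_nuclearNorm ha hnoise Δ
    rwa [traceInner_sum_left, Finset.sum_congr rfl fun t _ => traceInner_smul_left _ _ _] at this
  have hexp : ∑ t, (e t - traceInner (X (h t).1) Δ) ^ 2 = ∑ t, e t ^ 2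
      - 2 * ∑ t, e t * traceInner (X (h t).1) Δ + ∑ t, traceInner (X (h t).1) Δ ^ 2 := by
    rw [Finset.mul_sum, ← Finset.sum_sub_distrib, ← Finset.sum_add_distrib]
    exact Finset.sum_congr rfl fun t _ => by ring
  rw [hexp] at hΘ
  have hcross : 1 / (2 * (N : ℝ)) * (2 * ∑ t, e t * traceInner (X (h t).1) Δ)
      ≤ lam / 2 * nuclearNorm Δ := by
    calc 1 / (2 * (N : ℝ)) * (2 * ∑ t, e t * traceInner (X (h t).1) Δ)
        ≤ 1 / (2 * (N : ℝ)) * (2 * (a * nuclearNorm Δ)) := by gcongr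
      _ = lam / 2 * nuclearNorm Δ := by rw [hlam]; field_simp
  have n1 : nuclearNorm Δ ≤ nuclearNorm (perpPart s Δ) + nuclearNorm (Δ - perpPart s Δ) := by
    simpa using nuclearNorm_add_le (perpPart s Δ) (Δ - perpPart s Δ)
  have n2 := add_nuclearNorm_perpPart_le hs Δ
  have n3 : nuclearNorm (theta s + perpPart s Δ) ≤ nuclearNorm Θ
      + nuclearNorm (Δ - perpPart s Δ) := by
    have := nuclearNorm_add_le Θ (-(Δ - perpPart s Δ))
    rw [nuclearNorm_neg] at this
    have e : Θ + -(Δ - perpPart s Δ) = theta s + perpPart s Δ := by rw [hΔ]; abel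
    rwa [e] at this
  have n4 := nuclearNorm_theta_le s
  have n5 : lam * nuclearNorm (theta s) - lam * nuclearNorm Θ
      ≤ lam * (nuclearNorm (Δ - perpPart s Δ) - nuclearNorm (perpPart s Δ)) := by
    rw [← mul_sub]
    exact mul_le_mul_of_nonneg_left (by linarith) hlam0.le
  have n6 : lam / 2 * nuclearNorm Δ
      ≤ lam / 2 * (nuclearNorm (perpPart s Δ) + nuclearNorm (Δ - perpPart s Δ)) := by gcongr
  rw [mul_add, mul_sub] at hΘ
  linarith

/-- Restricted strong convexity turns the basic inequality into a Frobenius norm bound. The error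
lies in the cone, on which `‖Δ‖_nuc² ≤ 32 ‖Δ‖_F²`, so that `128 τ² ≤ κ` absorbs the tolerance. -/
lemma frobSq_sub_theta_le {ι : Type*} {N : ℕ} (hN : 0 < N) (hs : s ≠ 0) (h0 : ∑ i, s i = 0)
    {X : ι → Matrix V V ℝ} {h : Fin N → ι × ℝ} {e : Fin N → ℝ}
    (hh : ∀ t, (h t).2 = loss s (X (h t).1) + e t) {a lam : ℝ} (ha : 0 < a)
    (hlam : lam = 2 * a / N)
    (hnoise : ∀ x, ((∑ t, e t • X (h t).1) *ᵥ x) ⬝ᵥ ((∑ t, e t • X (h t).1) *ᵥ x)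
      ≤ a ^ 2 * (x ⬝ᵥ x)) {Θ : Matrix V V ℝ}
    (hΘ : objective X lam h Θ ≤ objective X lam h (theta s)) (hb : IsBalanced Θ) {κ τ2 : ℝ}
    (hκ : 0 < κ) (hτ : 0 ≤ τ2) (hκτ : 128 * τ2 ≤ κ) (hRSC : RSC (fun t => X (h t).1) s κ τ2) :
    κ ^ 2 * frobSq (Θ - theta s) ≤ 72 * lam ^ 2 := by
  have hN' : (0 : ℝ) < N := by exact_mod_cast hN
  have hlam0 : 0 < lam := by rw [hlam]; positivity
  have hbasic := sum_sq_le_of_objective_le hN hs hh ha hlam hnoise hΘ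
  set Δ := Θ - theta s with hΔ
  set m := nuclearNorm (Δ - perpPart s Δ) with hm
  set r := nuclearNorm (perpPart s Δ) with hr
  set f := frobSq Δ with hf
  have hm0 : 0 ≤ m := nuclearNorm_nonneg _
  have hr0 : 0 ≤ r := nuclearNorm_nonneg _
  have hf0 : 0 ≤ f := frobSq_nonneg _
  have hcone : r ≤ 3 * m := by
    have h1 : 0 ≤ 1 / (2 * (N : ℝ)) * ∑ t, traceInner (X (h t).1) Δ ^ 2 :=
      mul_nonneg (by positivity) (Finset.sum_nonneg fun t _ => sq_nonneg _)
    have h2 : 0 ≤ lam / 2 * (3 * m - r) := h1.trans hbasic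
    have h3 := (mul_nonneg_iff_of_pos_left (half_pos hlam0)).1 h2
    linarith
  have hR := (hRSC Δ (hb.sub (isBalanced_theta h0)) hcone).trans hbasic
  have hmf : m ^ 2 ≤ 2 * f := nuclearNorm_sub_perpPart_sq_le hs Δ
  have hn : nuclearNorm Δ ≤ 4 * m := by
    have : nuclearNorm Δ ≤ r + m := by
      simpa using nuclearNorm_add_le (perpPart s Δ) (Δ - perpPart s Δ)
    linarith
  have hn2 : nuclearNorm Δ ^ 2 ≤ 32 * f := by
    have := pow_le_pow_left₀ (nuclearNorm_nonneg Δ) hn 2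
    nlinarith
  have h1 : τ2 * nuclearNorm Δ ^ 2 ≤ κ / 4 * f := by
    calc τ2 * nuclearNorm Δ ^ 2 ≤ τ2 * (32 * f) := by gcongr
      _ = 128 * τ2 / 4 * f := by ring
      _ ≤ κ / 4 * f := by gcongr
  have h2 : κ * f ≤ 6 * lam * m := by
    have := mul_nonneg hlam0.le hr0
    rw [← hf] at hR
    linarith
  have h3 : (κ * f) ^ 2 ≤ (6 * lam * m) ^ 2 := pow_le_pow_left₀ (by positivity) h2 2
  rcases hf0.eq_or_lt with h4 | h4
  · rw [← h4, mul_zero]; positivity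
  · refine le_of_mul_le_mul_right ?_ h4
    calc κ ^ 2 * f * f = (κ * f) ^ 2 := by ring
      _ ≤ 36 * lam ^ 2 * m ^ 2 := h3.trans_eq (by ring)
      _ ≤ 36 * lam ^ 2 * (2 * f) := by gcongr
      _ = 72 * lam ^ 2 * f := by ring

end Estimation

/-! ### Regret decomposition -/

section Regret

/-- Stage 1 costs at most `‖s‖²` per round. In Stage 2 the reduced problem misses only the
quadratic form of the arm at the component of `s` orthogonal to `ŝ`. -/
lemma regret_le {ι : Type*} {s : V → ℝ} {G : ι → WeightedGraph V} {T₁ : ℕ} {lam : ℝ}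
    {Seed : Type*} (alg : ESTR (fun i => (G i).forest) T₁ lam Seed) (best : ι) (arm : ℕ → ι)
    (η : ℕ → ℝ) (T : ℕ) {w : ℝ}
    (hw : s ⬝ᵥ s - (alg.sHat (history (fun i => (G i).forest) s arm η 0 T₁) ⬝ᵥ s) ^ 2 ≤ w) :
    regret (fun i => (G i).forest) s best arm T
      ≤ T₁ * (s ⬝ᵥ s) + alg.subRegret s best arm η T + T * w := by
  set hist := history (fun i => (G i).forest) s arm η 0 T₁ with hhist
  set v := alg.sHat hist with hv
  have hv1 : v ⬝ᵥ v = 1 := (alg.sHat_top hist).1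
  have hS0 := dotProduct_self_nonneg s
  have hw0 : 0 ≤ w := by
    refine le_trans ?_ hw
    rw [← dotProduct_self_sub_smul hv1]; exact dotProduct_self_nonneg _
  have g1 : ∀ t, loss s (G (arm t)).forest - loss s (G best).forest ≤ s ⬝ᵥ s := by
    intro t
    rw [loss_eq, loss_eq]
    have := (G (arm t)).dotProduct_forest_le s
    have := (G best).dotProduct_forest_nonneg s
    linarith
  have g2 : ∀ t, loss s (G (arm t)).forest - loss s (G best).forest
      ≤ (alg.sub s arm η (G (arm t)).forest - alg.sub s arm η (G best).forest)
        ⬝ᵥ alg.sub s arm η (theta s) + w := by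
    intro t
    have hsp := alg.sPerp_orthonormal hist
    have hso := alg.sPerp_orthogonal hist
    have e := sub_dotProduct (reduce v (alg.sPerp hist) (G (arm t)).forest)
      (reduce v (alg.sPerp hist) (G best).forest) (reduce v (alg.sPerp hist) (theta s))
    have a1 := (G (arm t)).dotProduct_forest_le (s - (v ⬝ᵥ s) • v)
    have a2 := (G best).dotProduct_forest_nonneg (s - (v ⬝ᵥ s) • v)
    rw [dotProduct_self_sub_smul hv1] at a1
    rw [loss_eq, loss_eq, dotProduct_mulVec_eq_reduce_add hv1 hsp hso (G (arm t)).forest,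
      dotProduct_mulVec_eq_reduce_add hv1 hsp hso (G best).forest]
    simp only [ESTR.sub, ← hhist, ← hv]
    rw [e]
    linarith
  rw [regret, ESTR.subRegret]
  have hTw : 0 ≤ (T : ℝ) * w := by positivity
  rcases le_total T₁ T with hT | hT
  · rw [Finset.range_eq_Ico, ← Finset.sum_Ico_consecutive _ (Nat.zero_le T₁) hT, add_assoc]
    refine add_le_add ?_ ?_
    · refine (Finset.sum_le_sum fun t _ => g1 t).trans_eq ?_
      simp
    · refine (Finset.sum_le_sum fun t _ => g2 t).trans ?_
      rw [Finset.sum_add_distrib]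
      refine add_le_add le_rfl ?_
      rw [Finset.sum_const, Nat.card_Ico, nsmul_eq_mul]
      gcongr
      exact Nat.sub_le _ _
  -- Only Stage 1 is played, and the in-subspace regret is an empty sum.
  · rw [Finset.Ico_eq_empty_of_le hT, Finset.sum_empty, add_zero]
    refine (Finset.sum_le_sum fun t _ => g1 t).trans ?_
    rw [Finset.sum_const, Finset.card_range, nsmul_eq_mul]
    have : (T : ℝ) * (s ⬝ᵥ s) ≤ T₁ * (s ⬝ᵥ s) := by gcongr
    linarith

end Regret

/-! ### Choice of the parameters -/

section Parameters

/-- For a long horizon the tolerance condition follows from the size of the exploration length: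
`L / N ≤ (κ / b)²`, hence `τ² ≤ 2 cτ κ / b`, and `b` is chosen to make this at most `κ / 128`. -/
lemma tolerance_le_of_horizon {S κ τ2 c₁ cτ L T N b : ℝ} (hS : 0 < S) (hκ : 0 < κ) (hκ1 : κ ≤ 1)
    (hc₁ : 0 < c₁) (hcτ : 0 ≤ cτ) (hL : 0 < L) (hb : b = 256 * cτ + 1)
    (hN : c₁ * (1 / (S * κ) * √(T * L)) ≤ N) (hτ : τ2 ≤ cτ * (√(L / N) + L / N))
    (hT : b ^ 4 / c₁ ^ 2 * (S ^ 2 / κ ^ 2 * L) ≤ T) : 128 * τ2 ≤ κ := by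
  have hb1 : 1 ≤ b := by rw [hb]; linarith
  have hb0 : 0 < b := by linarith
  have h1 : b ^ 2 * S * L / (c₁ * κ) ≤ √(T * L) := by
    refine Real.le_sqrt_of_sq_le ?_
    calc (b ^ 2 * S * L / (c₁ * κ)) ^ 2 = b ^ 4 / c₁ ^ 2 * (S ^ 2 / κ ^ 2 * L) * L := by
          field_simp
      _ ≤ T * L := by gcongr
  have h2 : b ^ 2 * L / κ ^ 2 ≤ N := by
    refine le_trans ?_ hN
    calc b ^ 2 * L / κ ^ 2 = c₁ * (1 / (S * κ) * (b ^ 2 * S * L / (c₁ * κ))) := by field_simp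
      _ ≤ _ := by gcongr
  have hN0 : 0 < N := lt_of_lt_of_le (by positivity) h2
  have h3 : L / N ≤ (κ / b) ^ 2 := by
    rw [div_le_iff₀ hN0]
    rw [div_le_iff₀ (by positivity)] at h2
    rw [div_pow, div_mul_eq_mul_div, le_div_iff₀ (by positivity)]
    linarith
  have h4 : √(L / N) ≤ κ / b := by
    rw [Real.sqrt_le_left (by positivity)]; exact h3
  have h5 : (κ / b) ^ 2 ≤ κ / b := by
    rw [sq]
    refine mul_le_of_le_one_left (by positivity) ?_
    rw [div_le_one hb0]; linarith
  have h6 : τ2 ≤ cτ * (2 * (κ / b)) :=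
    hτ.trans (mul_le_mul_of_nonneg_left (by linarith) hcτ)
  calc 128 * τ2 ≤ 128 * (cτ * (2 * (κ / b))) := by gcongr
    _ = 256 * cτ / b * κ := by ring
    _ ≤ 1 * κ := by
        gcongr
        rw [div_le_one hb0]; linarith
    _ = κ := one_mul _

/-- The three contributions to the regret, for the prescribed exploration length. -/
lemma regret_bound_arith {S κ c₁ c₂ C₀ σ₀ L ℓ T N n lam f R : ℝ} {p : ℕ} (hS : 0 < S)
    (hκ : 0 < κ) (hc₁ : 0 < c₁) (hc₂ : 0 < c₂) (hC₀ : 0 ≤ C₀) (hL : 0 < L) (hℓ : 1 ≤ ℓ)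
    (hLℓ : L ≤ ℓ) (hT : 1 ≤ T) (hn : 1 ≤ n)
    (hN1 : c₁ * (1 / (S * κ) * √(T * L)) ≤ N) (hN2 : N ≤ c₂ * (1 / (S * κ) * √(T * L)))
    (hlam : lam = 2 * σ₀ * √(2 * L / N)) (hf : κ ^ 2 * f ≤ 72 * lam ^ 2)
    (hR : R ≤ N * S + C₀ * ℓ ^ p * ((2 * n - 1) * √T) + T * (2 * f / S)) :
    R ≤ (c₂ + 1152 * σ₀ ^ 2 / c₁ + 2 * C₀) * ℓ ^ (p + 1) * (max (1 / κ) √n * √(n * T)) := by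
  have hT0 : 0 < T := by linarith
  have hn0 : 0 < n := by linarith
  have hTL : 0 < √(T * L) := Real.sqrt_pos.2 (by positivity)
  have hN0 : 0 < N := lt_of_lt_of_le (by positivity) hN1
  set M := max (1 / κ) √n * √(n * T) with hM
  have hM0 : 0 ≤ M := by positivity
  have hTM : √(T * L) / κ ≤ ℓ * M := by
    have h1 : √L ≤ ℓ := by
      rw [Real.sqrt_le_left (by linarith)]; nlinarith
    have h2 : √T ≤ √(n * T) := Real.sqrt_le_sqrt (by nlinarith)
    calc √(T * L) / κ = √L * (1 / κ * √T) := by rw [Real.sqrt_mul hT0.le]; ring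
      _ ≤ ℓ * (max (1 / κ) √n * √(n * T)) := by
          gcongr
          exact le_max_left _ _
  have t1 : N * S ≤ c₂ * (ℓ * M) := by
    calc N * S ≤ c₂ * (1 / (S * κ) * √(T * L)) * S := by gcongr
      _ = c₂ * (√(T * L) / κ) := by field_simp
      _ ≤ _ := by gcongr
  have t3 : T * (2 * f / S) ≤ 1152 * σ₀ ^ 2 / c₁ * (ℓ * M) := by
    have hlam2 : lam ^ 2 = 8 * σ₀ ^ 2 * (L / N) := by
      rw [hlam, mul_pow, Real.sq_sqrt (by positivity)]; ring
    have hf' : f ≤ 576 * σ₀ ^ 2 * (L / N) / κ ^ 2 := by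
      rw [le_div_iff₀ (by positivity)]
      rw [hlam2] at hf
      linarith
    have hLN : L / N ≤ L / (c₁ * (1 / (S * κ) * √(T * L))) := by gcongr
    calc T * (2 * f / S) ≤ T * (2 * (576 * σ₀ ^ 2 * (L / (c₁ * (1 / (S * κ) * √(T * L)))) / κ ^ 2)
          / S) := by
          gcongr
          exact hf'.trans (by gcongr)
      _ = 1152 * σ₀ ^ 2 / c₁ * ((T * L) / √(T * L) / κ) := by field_simp; ring
      _ = 1152 * σ₀ ^ 2 / c₁ * (√(T * L) / κ) := by
          rw [Real.div_sqrt]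
      _ ≤ _ := by gcongr
  have t2 : C₀ * ℓ ^ p * ((2 * n - 1) * √T) ≤ 2 * C₀ * ℓ ^ p * M := by
    calc C₀ * ℓ ^ p * ((2 * n - 1) * √T) ≤ C₀ * ℓ ^ p * ((2 * n) * √T) := by
          gcongr; linarith
      _ = 2 * C₀ * ℓ ^ p * (√n * √(n * T)) := by
          rw [Real.sqrt_mul hn0.le, ← mul_assoc √n, Real.mul_self_sqrt hn0.le]; ring
      _ ≤ _ := by
          rw [hM]
          gcongr
          exact le_max_right _ _
  have q0 : 1 ≤ ℓ ^ p := one_le_pow₀ hℓ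
  have q1 : ℓ * M ≤ ℓ ^ (p + 1) * M := by
    rw [pow_succ]
    refine mul_le_mul_of_nonneg_right ?_ hM0
    nlinarith
  have q2 : ℓ ^ p * M ≤ ℓ ^ (p + 1) * M :=
    mul_le_mul_of_nonneg_right (pow_le_pow_right₀ hℓ (Nat.le_succ p)) hM0
  calc R ≤ c₂ * (ℓ * M) + 2 * C₀ * (ℓ ^ p * M) + 1152 * σ₀ ^ 2 / c₁ * (ℓ * M) := by linarith
    _ ≤ c₂ * (ℓ ^ (p + 1) * M) + 2 * C₀ * (ℓ ^ (p + 1) * M)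
        + 1152 * σ₀ ^ 2 / c₁ * (ℓ ^ (p + 1) * M) := by gcongr
    _ = _ := by ring

omit [DecidableEq V] in
lemma two_le_card_of_sum_eq_zero {s : V → ℝ} (h0 : ∑ i, s i = 0) (hs : s ≠ 0) :
    2 ≤ Fintype.card V := by
  by_contra! h
  have hsub : Subsingleton V := Fintype.card_le_one_iff_subsingleton.1 (by omega)
  refine hs (funext fun i => ?_)
  rwa [Fintype.sum_subsingleton _ i] at h0

end Parameters

end OPDMin

/-! ### The regret bound -/

theorem mainTheorem1
    (σ₀ c₁ c₂ cτ C₀ : ℝ) (p : ℕ)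
    (hσ₀ : 0 < σ₀) (hc₁ : 0 < c₁) (hc₁₂ : c₁ ≤ c₂) (hcτ : 0 ≤ cτ) (hC₀ : 0 ≤ C₀) :
    ∃ (B C : ℝ) (q : ℕ), 0 < B ∧ 0 < C ∧
      ∀ (V : Type*) [Fintype V] [DecidableEq V]
        -- the innate opinions
        (s : V → ℝ) (_ : ∀ i, |s i| ≤ 1) (_ : ∑ i, s i = 0) (_ : s ≠ 0)
        -- the intervention space and a best arm
        (K : ℕ) (G : Fin K → OPDMin.WeightedGraph V)
        (best : Fin K) (_ : ∀ i, OPDMin.loss s (G best).forest ≤ OPDMin.loss s (G i).forest)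
        -- the confidence parameter and the failure probabilities of the two assumptions
        (δ δ₁ δ₂ : ℝ) (_ : 0 < δ) (_ : δ < 1) (_ : 0 ≤ δ₁) (_ : 0 ≤ δ₂)
        -- the RSC parameters, the horizon and the exploration length
        (κ τ2 : ℝ) (_ : 0 < κ) (_ : 0 ≤ τ2) (T T₁ : ℕ) (_ : 1 ≤ T)
        (_ : c₁ * (1 / ((s ⬝ᵥ s) * κ) * √(T * Real.log (2 * Fintype.card V / δ))) ≤ T₁)
        (_ : T₁ ≤ c₂ * (1 / ((s ⬝ᵥ s) * κ) * √(T * Real.log (2 * Fintype.card V / δ))))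
        (_ : 128 * τ2 ≤ κ ∨
          (κ ≤ 1 ∧
            τ2 ≤ cτ * (√(Real.log (2 * Fintype.card V / δ) / T₁)
              + Real.log (2 * Fintype.card V / δ) / T₁) ∧
            B * ((s ⬝ᵥ s) ^ 2 / κ ^ 2 * Real.log (2 * Fintype.card V / δ)) ≤ T))
        -- the algorithm
        (Seed : Type*) [MeasurableSpace Seed]
        (alg : OPDMin.ESTR (fun i => (G i).forest) T₁
          (2 * σ₀ * √(2 * Real.log (2 * Fintype.card V / δ) / T₁)) Seed)
        -- a random run of the algorithm
        (Ω : Type*) [MeasurableSpace Ω] (μ : Measure Ω) [IsProbabilityMeasure μ]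
        (σ : ℝ≥0) (_ : (σ : ℝ) ≤ σ₀)
        (η : ℕ → Ω → ℝ) (_ : ∀ t, Measurable (η t))
        (_ : ∀ t, μ.map (η t) = gaussianReal 0 (σ ^ 2)) (_ : iIndepFun η μ)
        (U : Ω → Seed) (_ : Measurable U)
        (arm : ℕ → Ω → Fin K) (_ : ∀ t, Measurable (arm t))
        (_ : IndepFun (fun ω => ((fun t : Fin T₁ => arm t ω), U ω)) (fun ω t => η t ω) μ)
        (_ : ∀ ω, alg.Follows s (fun t => arm t ω) (fun t => η t ω) (U ω))
        -- restricted strong convexity of the exploration design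
        (_ : μ {ω | ¬ OPDMin.RSC (fun t : Fin T₁ => (G (arm t ω)).forest) s κ τ2}
          ≤ ENNReal.ofReal δ₁)
        -- the regret bound of the Stage 2 linear bandit in dimension `2|V| - 1`
        (_ : μ {ω | ¬ alg.subRegret s best (fun t => arm t ω) (fun t => η t ω) T
            ≤ C₀ * Real.log (2 * Fintype.card V * T / δ) ^ p
              * ((2 * Fintype.card V - 1) * √T)} ≤ ENNReal.ofReal δ₂),
        ENNReal.ofReal (1 - δ - δ₁ - δ₂) ≤
          μ {ω | OPDMin.regret (fun i => (G i).forest) s best (fun t => arm t ω) T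
            ≤ C * Real.log (2 * Fintype.card V * T / δ) ^ q
              * (max (1 / κ) √(Fintype.card V) * √(Fintype.card V * T))} := by
  refine ⟨(256 * cτ + 1) ^ 4 / c₁ ^ 2, c₂ + 1152 * σ₀ ^ 2 / c₁ + 2 * C₀, p + 1,
    by positivity, by have := hc₁.trans_le hc₁₂; positivity, ?_⟩
  intro V _ _ s _ h0 hs K G best _ δ δ₁ δ₂ hδ hδ1 hδ₁ hδ₂ κ τ2 hκ hτ2 T T₁ hT
  have hcard : (2 : ℝ) ≤ Fintype.card V := by
    exact_mod_cast OPDMin.two_le_card_of_sum_eq_zero h0 hs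
  have hTr : (1 : ℝ) ≤ T := by exact_mod_cast hT
  have hS := OPDMin.dotProduct_self_pos hs
  generalize hLdef : Real.log (2 * Fintype.card V / δ) = L
  generalize hℓdef : Real.log (2 * Fintype.card V * T / δ) = ℓ
  generalize hn : (Fintype.card V : ℝ) = n at *
  intro hT₁l hT₁u hcase Seed _ alg Ω _ μ _ σ hσ η hη hlaw hind U _ arm harm hindep _ hRSC hsub
  have hexp1 : Real.exp 1 ≤ 2 * n / δ := by
    rw [le_div_iff₀ hδ]
    have := Real.exp_one_lt_d9
    nlinarith [Real.exp_pos 1]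
  have hL1 : 1 ≤ L := hLdef ▸ (Real.le_log_iff_exp_le (by positivity)).2 hexp1
  have hL0 : 0 < L := by linarith
  have hLℓ : L ≤ ℓ := by
    rw [← hLdef, ← hℓdef]
    refine Real.log_le_log (by positivity) (div_le_div_of_nonneg_right ?_ hδ.le)
    exact le_mul_of_one_le_right (by positivity) hTr
  have hT₁0 : (0 : ℝ) < T₁ := lt_of_lt_of_le (by positivity) hT₁l
  have hT₁pos : 0 < T₁ := by exact_mod_cast hT₁0
  have hκτ : 128 * τ2 ≤ κ := by
    rcases hcase with h | ⟨h1, h2, h3⟩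
    · exact h
    · exact OPDMin.tolerance_le_of_horizon hS hκ h1 hc₁ hcτ hL0 rfl hT₁l h2 h3
  have hδL : 2 * (Fintype.card V : ℝ) * Real.exp (-L) = δ := by
    rw [hn, ← hLdef, Real.exp_neg, Real.exp_log (by positivity)]
    field_simp
  -- The noise event, by the matrix Gaussian tail bound conditionally on the exploration arms.
  have hnoise := OPDMin.measure_not_noise_bound_le (μ := μ) (V := V) hT₁pos
    (η := fun t : Fin T₁ => η t) (v := σ ^ 2) (fun t => hη t) (fun t => hlaw t)
    (hind.precomp Fin.val_injective) hσ₀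
    (by push_cast; exact pow_le_pow_left₀ σ.2 hσ 2)
    (X := fun i => (G i).forest) (fun i => (G i).forest_transpose)
    (fun i => (G i).forest_isContraction) (arm := fun ω t => arm t ω)
    (measurable_pi_lambda _ fun t => harm t)
    (hindep.comp (φ := Prod.fst) (ψ := fun (x : ℕ → ℝ) (t : Fin T₁) => x t) measurable_fst
      (measurable_pi_lambda _ fun t => measurable_pi_apply _)) hL0 hδL
  have hcover : (Set.univ : Set Ω) ⊆
      {ω | OPDMin.regret (fun i => (G i).forest) s best (fun t => arm t ω) T
        ≤ (c₂ + 1152 * σ₀ ^ 2 / c₁ + 2 * C₀) * ℓ ^ (p + 1) * (max (1 / κ) √n * √(n * T))} ∪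
      ({ω | ¬ ∀ x, ((∑ t : Fin T₁, η t ω • (G (arm t ω)).forest) *ᵥ x) ⬝ᵥ
          ((∑ t : Fin T₁, η t ω • (G (arm t ω)).forest) *ᵥ x)
          ≤ (σ₀ * √(2 * L * T₁)) ^ 2 * (x ⬝ᵥ x)} ∪
        ({ω | ¬ OPDMin.RSC (fun t : Fin T₁ => (G (arm t ω)).forest) s κ τ2} ∪
          {ω | ¬ alg.subRegret s best (fun t => arm t ω) (fun t => η t ω) T
            ≤ C₀ * ℓ ^ p * ((2 * n - 1) * √T)})) := by
    intro ω _
    simp only [Set.mem_union, Set.mem_ofPred_eq]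
    by_contra! hcon
    obtain ⟨hreg, hno, hrsc, hsb⟩ := hcon
    refine absurd hreg (not_lt.2 ?_)
    set hist := OPDMin.history (fun i => (G i).forest) s (fun t => arm t ω) (fun t => η t ω) 0 T₁
      with hhist
    have hist1 : ∀ t : Fin T₁, (hist t).1 = arm t ω := fun t => by
      simp [hhist, OPDMin.history]
    have hist2 : ∀ t : Fin T₁, (hist t).2
        = OPDMin.loss s (G (hist t).1).forest + η t ω := fun t => by
      simp [hhist, OPDMin.history]
    have hpen : 2 * σ₀ * √(2 * L / T₁) = 2 * (σ₀ * √(2 * L * T₁)) / T₁ := by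
      have e : √(2 * L * T₁) = √(2 * L / T₁) * T₁ := by
        rw [show 2 * L * T₁ = 2 * L / T₁ * (T₁ : ℝ) ^ 2 by field_simp,
          Real.sqrt_mul (by positivity), Real.sqrt_sq hT₁0.le]
      rw [e]
      field_simp
    have hfrob := OPDMin.frobSq_sub_theta_le hT₁pos hs h0 (X := fun i => (G i).forest)
      (h := hist) (e := fun t => η t ω) hist2 (a := σ₀ * √(2 * L * T₁)) (by positivity) hpen
      (by simpa only [hist1] using hno) (alg.thetaHat_min hist _) (alg.thetaHat_balanced hist)
      hκ hτ2 hκτ (by simpa only [hist1] using hrsc)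
    have hsin := OPDMin.dotProduct_self_mul_le_of_isTopEigenvector hs (alg.sHat_top hist)
    rw [OPDMin.dotProduct_self_sub_smul (alg.sHat_top hist).1] at hsin
    have hR := OPDMin.regret_le alg best (fun t => arm t ω) (fun t => η t ω) T
      ((le_div_iff₀' hS).2 hsin)
    exact OPDMin.regret_bound_arith hS hκ hc₁ (hc₁.trans_le hc₁₂) hC₀ hL0 (hL1.trans hLℓ) hLℓ hTr
      (by linarith) hT₁l hT₁u rfl hfrob 
      (hR.trans (add_le_add (add_le_add le_rfl hsb) le_rfl))
  have htotal := (measure_mono hcover).trans ((measure_union_le _ _).trans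
    (add_le_add le_rfl ((measure_union_le _ _).trans
      (add_le_add hnoise ((measure_union_le _ _).trans (add_le_add hRSC hsub))))))
  rw [measure_univ, ← ENNReal.ofReal_add hδ₁ hδ₂, ← ENNReal.ofReal_add hδ.le (by positivity)]
    at htotal
  rw [show 1 - δ - δ₁ - δ₂ = 1 - (δ + (δ₁ + δ₂)) by ring,
    ENNReal.ofReal_sub _ (by positivity), ENNReal.ofReal_one]
  exact tsub_le_iff_right.2 htotal
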